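/- Let $d\ge 3$ and let $q$ be a prime power. Let $V$ be a finite-dimensional vector space carrying a form of one of the following three types: (1) $\dim V=2d+1$ over $\mathbb F_q$, with a quadratic form $Q$ that is nondegenerate, i.e. no nonzero $v\in V$ satisfies $Q(v)=0$ and $Q(v+w)=Q(w)$ for all $w\in V$; (2) $\dim V=2d$ over $\mathbb F_q$, with a nondegenerate alternating bilinear form; (3) $\dim V=2d$ over $\mathbb F_{q^2}$, with a nondegenerate Hermitian form with respect to the involution $x\mapsto x^q$. The associated dual polar space, denoted $\mathsf{DQ}(2d,q)$, $\mathsf{DW}(2d-1,q)$ and $\mathsf{DH}(2d-1,q^2)$ respectively, is the point-line geometry whose points are the maximal totally singular (in case (1)) or totally isotropic (in cases (2) and (3)) subspaces of $V$, whose lines are the next-to-maximal ones (the subspaces of codimension one in some maximal one), and in which incidence is containment. An $m$-ovoid is a set $\mathcal O$ of points such that every line is incident with exactly $m$ points of $\mathcal O$; it is nontrivial if it is neither empty nor the set of all points; it is a hemisystem if $m$ is exactly half of the number of points on each line. Then every nontrivial $m$-ovoid of $\mathsf{DQ}(2d,q)$, of $\mathsf{DW}(2d-1,q)$ and of $\mathsf{DH}(2d-1,q^2)$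 is a hemisystem, and $m=(q+1)/2$. -/

import Mathlib

/-- A point-line geometry: points, lines and an incidence relation. -/
structure PointLineGeometry where
  /-- The points. -/
  Point : Type*
  /-- The lines. -/
  Line : Type*
  /-- The point `p` is incident with the line `l`. -/
  Inc : Point → Line → Prop

namespace PointLineGeometry

/-- The set of points incident with the line `l`. -/
def pointsOn (G : PointLineGeometry) (l : G.Line) : Set G.Point :=
  {p | G.Inc p l}

/-- An `m`-ovoid: a set of points such that every line is incident with exactly `m` of them. -/
def IsMOvoid (G : PointLineGeometry) (m : ℕ) (O : Set G.Point) : Prop :=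
  ∀ l : G.Line, (O ∩ G.pointsOn l).encard = m

/-- A set of points is nontrivial if it is neither empty nor the full set of points. -/
def IsNontrivial (G : PointLineGeometry) (O : Set G.Point) : Prop :=
  O ≠ ∅ ∧ O ≠ Set.univ

/-- A hemisystem: an `m`-ovoid where `m` is exactly half of the number of points on a line. -/
def IsHemisystem (G : PointLineGeometry) (O : Set G.Point) : Prop :=
  ∃ m : ℕ, G.IsMOvoid m O ∧ ∀ l : G.Line, (G.pointsOn l).encard = 2 * m

end PointLineGeometry

/-- The dual of the polar space whose subspaces are the linear subspaces of `V` satisfying `S`.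
The points are the maximal members of `S`, the lines are the next-to-maximal ones (the hyperplanes
of the maximal ones), and incidence is containment. -/
def dualPolarSpace {F V : Type*} [Field F] [AddCommGroup V] [Module F V]
    (S : Submodule F V → Prop) : PointLineGeometry where
  Point := {M : Submodule F V // Maximal S M}
  Line := {L : Submodule F V // S L ∧ ∃ M : Submodule F V, Maximal S M ∧ L ⋖ M}
  Inc M L := L.1 ≤ M.1

/-- `DQ(2d, q)`, for `Q` a nondegenerate quadratic form on a `(2d+1)`-dimensional space over the
field with `q` elements: the dual polar space of the totally singular subspaces of `Q`. -/
def DQ {F V : Type*} [Field F] [AddCommGroup V] [Module F V]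
    (Q : QuadraticForm F V) : PointLineGeometry :=
  dualPolarSpace fun W : Submodule F V => ∀ x ∈ W, Q x = 0

/-- `DW(2d-1, q)`, for `B` a nondegenerate alternating form on a `2d`-dimensional space over the
field with `q` elements: the dual polar space of the totally isotropic subspaces of `B`. -/
def DW {F V : Type*} [Field F] [AddCommGroup V] [Module F V]
    (B : LinearMap.BilinForm F V) : PointLineGeometry :=
  dualPolarSpace fun W : Submodule F V => ∀ x ∈ W, ∀ y ∈ W, B x y = 0

/-- `DH(2d-1, q²)`, for `H` a nondegenerate Hermitian form on a `2d`-dimensional space over the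
field with `q²` elements: the dual polar space of the totally isotropic subspaces of `H`. -/
def DH {F V : Type*} [Field F] [AddCommGroup V] [Module F V] {σ : F →+* F}
    (H : V →ₛₗ[σ] V →ₗ[F] F) : PointLineGeometry :=
  dualPolarSpace fun W : Submodule F V => ∀ x ∈ W, ∀ y ∈ W, H x y = 0

/-!
Let `O` be a nontrivial `m`-ovoid and let `s + 1` be the number of points on a line. The maximal
totally singular subspaces through a fixed totally singular subspace `U` of codimension three in
them form a regular near hexagon (`IsPolarSystem.isRegularNearHexagon`), and `O` restricts to an
`m`-ovoid of it with `0 < m < s + 1`. So it suffices to treat regular near hexagons whose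
parameters are those of a dual polar space of rank three over a field with `Q` elements, where
`Q = s` (quadratic and symplectic spaces) or `Q = s ^ 2` (Hermitian spaces).

In such a near hexagon let `E x y = (-1 / s) ^ δ x y`. Up to scaling, `E` is the projection onto the
space `K` of the functions that sum to zero on each line: a line has one point at distance `i` from
`x` and `s` points at distance `i + 1`, so the rows of `E` lie in `K`, and the sums of a function of
`K` over the spheres around `x` are multiples of its value at `x`
(`IsRegularNearHexagon.sum_sphere_succ`, `IsRegularNearHexagon.sum_radial_mul`). The sum of the
cubes of the entries in a row of `E` is `(1 - 1 / s ^ 2) * (1 - Q / s ^ 2) * (1 - Q ^ 2 / s ^ 2)`,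
which vanishes in both cases. This is the vanishing of a Krein parameter, and it forces
`∑ x, v x ^ 3 = 0` for all `v` in `K`
(`sum_pow_three_eq_zero_of_sum_pow_three_entries_eq_zero`). The function
`(s + 1) 1_O - m` lies in `K` and takes the two values `s + 1 - m > 0` and `-m < 0`; its sum and the
sum of its cubes both vanish only if these are opposite, that is `2 * m = s + 1`
(`IsRegularNearHexagon.two_mul_eq`).

The geometry of totally singular subspaces is developed once for the three types of forms, in
`IsPolarSystem`. What depends on the type is the Witt index, for which it has to be shown that
anisotropic spaces have small dimension, and the number of points on a line. The latter is the
number of singular points of the orthogonal complement of the line modulo the line: those of a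
conic, all points of a symplectic plane, or the isotropic points of a Hermitian plane
(`IsPolarSystem.ncard_maximal_ge`).
-/

/-! ### Regular near hexagons and a vanishing Krein parameter -/

/-- A regular near hexagon on the points `P` and the lines `Λ`, with incidence `I` and distance
function `δ`, whose lines have `s + 1` points and whose parameters are those of a dual polar space
of rank three: through a point `y` at distance `i` from `x` there are `1 + Q + ⋯ + Q ^ (i - 1)`
lines that contain a point closer to `x`, and `1 + Q + Q ^ 2` lines in all. -/
structure IsRegularNearHexagon {P Λ : Type*} (I : P → Λ → Prop) (δ : P → P → ℕ) (s Q : ℕ) :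
    Prop where
  symm : ∀ x y, δ x y = δ y x
  eq_zero : ∀ x y, δ x y = 0 ↔ x = y
  le_three : ∀ x y, δ x y ≤ 3
  exists_gate : ∀ x L, ∃ z, I z L ∧ ∀ y, I y L → y ≠ z → δ x y = δ x z + 1
  card_line : ∀ L, {y | I y L}.ncard = s + 1
  card_point : ∀ y, {L | I y L}.ncard = ∑ j ∈ Finset.range 3, Q ^ j
  card_toward : ∀ x y, {L | I y L ∧ ∃ z, I z L ∧ δ x z + 1 = δ x y}.ncard =
    ∑ j ∈ Finset.range (δ x y), Q ^ j

open Classical in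
/-- A double count over the lines at distance `i` from `x`: the part of each such line outside its
gate consists of points at distance `i + 1`. With `lam = s` and `w = 1` it gives the sizes of the
spheres around `x`, with `lam = -1` the sums over these spheres of a function that sums to zero on
each line. -/
theorem IsRegularNearHexagon.sum_sphere_succ {P Λ : Type*} [Fintype P] [Fintype Λ]
    {I : P → Λ → Prop} {δ : P → P → ℕ} {s Q : ℕ} (h : IsRegularNearHexagon I δ s Q)
    {w : P → ℝ} {lam : ℝ}
    (hw : ∀ L z, I z L → ∑ y with (I y L ∧ y ≠ z), w y = lam * w z) (x : P) (i : ℕ) :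
    (∑ j ∈ Finset.range (i + 1), (Q : ℝ) ^ j) * ∑ y with δ x y = i + 1, w y =
      lam * ((∑ j ∈ Finset.range 3, (Q : ℝ) ^ j - ∑ j ∈ Finset.range i, (Q : ℝ) ^ j) *
        ∑ y with δ x y = i, w y) := by
  choose g hg hgu using h.exists_gate x
  have toward : ∀ y L, I y L → ((∃ z, I z L ∧ δ x z + 1 = δ x y) ↔ y ≠ g L) := by
    intro y L hy
    constructor
    · rintro ⟨z, hz, hzy⟩ rfl
      by_cases hzg : z = g L
      · subst hzg; omega
      · have := hgu L z hz hzg; omega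
    · intro hne
      exact ⟨g L, hg L, (hgu L y hy hne).symm⟩
  have hsum : ∑ L with δ x (g L) = i, ∑ y with (I y L ∧ y ≠ g L), w y =
      ∑ L with δ x (g L) = i, lam * w (g L) :=
    Finset.sum_congr rfl fun L _ => hw L (g L) (hg L)
  have hleft : ∑ L with δ x (g L) = i, ∑ y with (I y L ∧ y ≠ g L), w y =
      ∑ y with δ x y = i + 1, ∑ L with (I y L ∧ ∃ z, I z L ∧ δ x z + 1 = δ x y), w y := by
    refine Finset.sum_comm' fun L y => ?_
    simp only [Finset.mem_filter, Finset.mem_univ, true_and]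
    constructor
    · rintro ⟨h1, h2, h3⟩
      have := hgu L y h2 h3
      exact ⟨⟨h2, (toward y L h2).2 h3⟩, by omega⟩
    · rintro ⟨⟨h1, h2⟩, h3⟩
      have h4 := (toward y L h1).1 h2
      have := hgu L y h1 h4
      exact ⟨by omega, h1, h4⟩
  have hright : ∑ L with δ x (g L) = i, lam * w (g L) =
      ∑ y with δ x y = i, ∑ L with g L = y, lam * w y := by
    rw [Finset.sum_comm' (t' := Finset.univ.filter fun L => δ x (g L) = i)
      (s' := fun L => {g L})]
    · simp
    · intro y L
      simp only [Finset.mem_filter, Finset.mem_univ, true_and, Finset.mem_singleton]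
      constructor
      · rintro ⟨h1, rfl⟩; exact ⟨rfl, h1⟩
      · rintro ⟨rfl, h1⟩; exact ⟨h1, rfl⟩
  have hcard : ∀ y, ((Finset.univ.filter fun L => g L = y).card : ℝ) =
      ∑ j ∈ Finset.range 3, (Q : ℝ) ^ j - ∑ j ∈ Finset.range (δ x y), (Q : ℝ) ^ j := by
    intro y
    have h1 := h.card_toward x y
    have h2 := h.card_point y
    rw [Set.ncard_eq_toFinset_card', Set.toFinset_ofPred] at h1 h2
    have h3 : (Finset.univ.filter fun L => g L = y) ∪
        (Finset.univ.filter fun L => I y L ∧ ∃ z, I z L ∧ δ x z + 1 = δ x y) =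
        Finset.univ.filter fun L => I y L := by
      ext L
      simp only [Finset.mem_union, Finset.mem_filter, Finset.mem_univ, true_and]
      constructor
      · rintro (rfl | h3)
        · exact hg L
        · exact h3.1
      · intro h3
        by_cases h4 : y = g L
        · exact Or.inl h4.symm
        · exact Or.inr ⟨h3, (toward y L h3).2 h4⟩
    have h4 : Disjoint (Finset.univ.filter fun L => g L = y)
        (Finset.univ.filter fun L => I y L ∧ ∃ z, I z L ∧ δ x z + 1 = δ x y) := by
      rw [Finset.disjoint_filter]
      rintro L - h4 ⟨h5, h6⟩
      exact (toward y L h5).1 h6 h4.symm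
    have h5 := Finset.card_union_of_disjoint h4
    rw [h3, h1, h2] at h5
    have h6 := congrArg (Nat.cast (R := ℝ)) h5
    push_cast at h6
    linarith
  rw [hleft, hright] at hsum
  have e1 : ∑ y with δ x y = i + 1, ∑ L with (I y L ∧ ∃ z, I z L ∧ δ x z + 1 = δ x y), w y =
      (∑ j ∈ Finset.range (i + 1), (Q : ℝ) ^ j) * ∑ y with δ x y = i + 1, w y := by
    rw [Finset.mul_sum]
    refine Finset.sum_congr rfl fun y hy => ?_
    have h1 := h.card_toward x y
    rw [Set.ncard_eq_toFinset_card', Set.toFinset_ofPred] at h1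
    rw [Finset.sum_const, h1, nsmul_eq_mul, (Finset.mem_filter.1 hy).2]
    push_cast
    rfl
  have e2 : ∑ y with δ x y = i, ∑ L with g L = y, lam * w y =
      lam * ((∑ j ∈ Finset.range 3, (Q : ℝ) ^ j - ∑ j ∈ Finset.range i, (Q : ℝ) ^ j) *
        ∑ y with δ x y = i, w y) := by
    rw [Finset.mul_sum, Finset.mul_sum]
    refine Finset.sum_congr rfl fun y hy => ?_
    rw [Finset.sum_const, nsmul_eq_mul, hcard y, (Finset.mem_filter.1 hy).2]
    ring
  rw [← e1, hsum, e2]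

open Classical in
/-- The sphere sums, solved for the parameters `1`, `Q + 1`, `Q ^ 2 + Q + 1` of the near hexagon. -/
theorem IsRegularNearHexagon.sum_radial_mul {P Λ : Type*} [Fintype P] [Fintype Λ]
    {I : P → Λ → Prop} {δ : P → P → ℕ} {s Q : ℕ} (h : IsRegularNearHexagon I δ s Q)
    {w : P → ℝ} {lam : ℝ}
    (hw : ∀ L z, I z L → ∑ y with (I y L ∧ y ≠ z), w y = lam * w z) (x : P) (f : ℕ → ℝ) :
    ∑ y, f (δ x y) * w y =
      (f 0 + f 1 * lam * (Q ^ 2 + Q + 1) + f 2 * lam ^ 2 * (Q * (Q ^ 2 + Q + 1)) +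
        f 3 * lam ^ 3 * Q ^ 3) * w x := by
  have hfib : ∑ y, f (δ x y) * w y =
      ∑ i ∈ Finset.range 4, f i * ∑ y with δ x y = i, w y := by
    rw [← Finset.sum_fiberwise_of_maps_to (s := Finset.univ) (t := Finset.range 4)
      (g := fun y => δ x y)]
    · refine Finset.sum_congr rfl fun i _ => ?_
      rw [Finset.mul_sum]
      refine Finset.sum_congr rfl fun y hy => ?_
      rw [(Finset.mem_filter.1 hy).2]
    · intro y _
      have := h.le_three x y
      simp only [Finset.mem_range]
      omega
  have h0 : ∑ y with δ x y = 0, w y = w x := by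
    refine Finset.sum_eq_single x ?_ ?_
    · intro y hy hne
      exact absurd ((h.eq_zero x y).1 (Finset.mem_filter.1 hy).2).symm hne
    · intro hx
      exact absurd (Finset.mem_filter.2 ⟨Finset.mem_univ x, (h.eq_zero x x).2 rfl⟩) hx
  have h1 := h.sum_sphere_succ hw x 0
  have h2 := h.sum_sphere_succ hw x 1
  have h3 := h.sum_sphere_succ hw x 2
  rw [hfib]
  simp only [Finset.sum_range_succ, Finset.sum_range_zero, zero_add, pow_zero, pow_one,
    one_mul, sub_zero, Nat.reduceAdd] at h1 h2 h3 ⊢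
  have hQ : (0 : ℝ) ≤ Q := Nat.cast_nonneg Q
  have hQ1 : (1 : ℝ) + Q ≠ 0 := by positivity
  have hQ2 : (1 : ℝ) + Q + Q ^ 2 ≠ 0 := by positivity
  rw [h0] at h1 ⊢
  have h2' : ∑ y with δ x y = 2, w y = lam * Q * ∑ y with δ x y = 1, w y :=
    mul_left_cancel₀ hQ1 (by rw [h2]; ring)
  have h3' : ∑ y with δ x y = 3, w y = lam ^ 3 * Q ^ 3 * w x :=
    mul_left_cancel₀ hQ2 (by rw [h3, h2', h1]; ring)
  rw [h3', h2', h1]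
  ring

theorem Finset.sum_pow_three {ι R : Type*} [CommSemiring R] (s : Finset ι) (f : ι → R) :
    (∑ a ∈ s, f a) ^ 3 = ∑ a ∈ s, ∑ b ∈ s, ∑ c ∈ s, f a * f b * f c := by
  rw [pow_succ, pow_two, Finset.sum_mul_sum, Finset.sum_mul]
  refine Finset.sum_congr rfl fun a _ => ?_
  rw [Finset.sum_mul_sum]

/-- If a symmetric matrix `E` satisfies `E ^ 2 = κ E` with `κ ≠ 0` and its entrywise cube sums to
zero, then the cube of each `κ`-eigenvector sums to zero: the vanishing of a Krein parameter. The
squares of the numbers `∑ x, E x a * E x b * E x c` add up to `κ ^ 3` times the sum of the cubes of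
the entries of `E`, so all these numbers vanish. -/
theorem sum_pow_three_eq_zero_of_sum_pow_three_entries_eq_zero {P : Type*} [Fintype P]
    {E : P → P → ℝ} {κ : ℝ} (hκ : κ ≠ 0)
    (hsq : ∀ x y, ∑ a, E x a * E y a = κ * E x y) (hcube : ∑ x, ∑ y, E x y ^ 3 = 0)
    {v : P → ℝ} (hv : ∀ x, ∑ a, E x a * v a = κ * v x) : ∑ x, v x ^ 3 = 0 := by
  have hprod : ∀ f : P → ℝ,
      (∑ a, f a) ^ 3 = ∑ p : P × P × P, f p.1 * f p.2.1 * f p.2.2 := by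
    intro f
    rw [Finset.sum_pow_three]
    simp_rw [Fintype.sum_prod_type]
  have key : ∑ p : P × P × P, (∑ x, E x p.1 * E x p.2.1 * E x p.2.2) ^ 2 = 0 :=
    calc
      _ = ∑ p : P × P × P, ∑ x, ∑ y, (E x p.1 * E y p.1) * (E x p.2.1 * E y p.2.1) *
          (E x p.2.2 * E y p.2.2) := by
        refine Finset.sum_congr rfl fun p _ => ?_
        rw [pow_two, Finset.sum_mul_sum]
        refine Finset.sum_congr rfl fun x _ => Finset.sum_congr rfl fun y _ => ?_
        ring
      _ = ∑ x, ∑ y, (∑ a, E x a * E y a) ^ 3 := by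
        rw [Finset.sum_comm]
        refine Finset.sum_congr rfl fun x _ => ?_
        rw [Finset.sum_comm]
        exact Finset.sum_congr rfl fun y _ => (hprod fun a => E x a * E y a).symm
      _ = 0 := by
        simp_rw [hsq, mul_pow, ← Finset.mul_sum]
        rw [hcube, mul_zero]
  have hF : ∀ p : P × P × P, ∑ x, E x p.1 * E x p.2.1 * E x p.2.2 = 0 := fun p =>
    (pow_eq_zero_iff two_ne_zero).1
      ((Finset.sum_eq_zero_iff_of_nonneg fun p _ => sq_nonneg _).1 key p (Finset.mem_univ p))
  have h2 : ∑ x, (∑ a, E x a * v a) ^ 3 = 0 :=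
    calc
      _ = ∑ x, ∑ p : P × P × P,
          (E x p.1 * E x p.2.1 * E x p.2.2) * (v p.1 * v p.2.1 * v p.2.2) := by
        refine Finset.sum_congr rfl fun x _ => ?_
        rw [hprod]
        refine Finset.sum_congr rfl fun p _ => ?_
        ring
      _ = 0 := by
        rw [Finset.sum_comm]
        simp_rw [← Finset.sum_mul, hF, zero_mul, Finset.sum_const_zero]
  simp_rw [hv, mul_pow, ← Finset.mul_sum] at h2
  exact (mul_eq_zero.1 h2).resolve_left (pow_ne_zero 3 hκ)

open Classical in
theorem sum_ne_eq_neg_of_sum_eq_zero {P Λ : Type*} [Fintype P]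
    {I : P → Λ → Prop} {w : P → ℝ} {L : Λ} (hw : ∑ y with I y L, w y = 0) {z : P} (hz : I z L) :
    ∑ y with (I y L ∧ y ≠ z), w y = -1 * w z := by
  have : (Finset.univ.filter fun y => I y L ∧ y ≠ z) =
      (Finset.univ.filter fun y => I y L).erase z := by
    ext y
    simp [and_comm]
  rw [this]
  have := Finset.add_sum_erase (Finset.univ.filter fun y => I y L) w (a := z) (by simpa using hz)
  rw [hw] at this
  linarith

open Classical in
/-- The entries `(-1 / s) ^ δ x y` span the eigenspace of the functions that sum to zero on each
line. The sum of the cubes of the entries in a row is a `q`-binomial sum, equal to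
`(1 - 1 / s ^ 2) * (1 - Q / s ^ 2) * (1 - Q ^ 2 / s ^ 2)`. -/
theorem IsRegularNearHexagon.sum_pow_three_eq_zero {P Λ : Type*} [Fintype P] [Fintype Λ]
    {I : P → Λ → Prop} {δ : P → P → ℕ} {s Q : ℕ} (h : IsRegularNearHexagon I δ s Q)
    (hs : 0 < s) (hQ : Q = s ∨ Q = s ^ 2)
    {v : P → ℝ} (hv : ∀ L, ∑ y with I y L, v y = 0) : ∑ x, v x ^ 3 = 0 := by
  have hs0 : (s : ℝ) ≠ 0 := by positivity
  set r : ℝ := -1 / s with hr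
  have hcard : ∀ L z, I z L → (∑ y with (I y L ∧ y ≠ z), (1 : ℝ)) = s := by
    intro L z hz
    have h1 := h.card_line L
    rw [Set.ncard_eq_toFinset_card', Set.toFinset_ofPred] at h1
    have h2 : (Finset.univ.filter fun y => I y L ∧ y ≠ z) =
        (Finset.univ.filter fun y => I y L).erase z := by
      ext y
      simp [and_comm]
    rw [Finset.sum_const, nsmul_eq_mul, mul_one, h2,
      Finset.card_erase_of_mem (by simpa using hz), h1, Nat.add_sub_cancel]
  have hrow : ∀ x L, ∑ y with I y L, r ^ δ x y = 0 := by
    intro x L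
    obtain ⟨z, hz, hzu⟩ := h.exists_gate x L
    have h2 : (Finset.univ.filter fun y => I y L ∧ y ≠ z) =
        (Finset.univ.filter fun y => I y L).erase z := by
      ext y
      simp [and_comm]
    rw [← Finset.add_sum_erase (Finset.univ.filter fun y => I y L) _ (a := z) (by simpa using hz),
      ← h2]
    have h3 : ∑ y with (I y L ∧ y ≠ z), r ^ δ x y =
        ∑ y with (I y L ∧ y ≠ z), r ^ (δ x z + 1) * 1 := by
      refine Finset.sum_congr rfl fun y hy => ?_
      obtain ⟨-, h4, h5⟩ := Finset.mem_filter.1 hy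
      rw [hzu y h4 h5, mul_one]
    rw [h3, ← Finset.mul_sum, hcard L z hz, pow_succ, hr]
    field_simp
    ring
  have heig : ∀ w : P → ℝ, (∀ L, ∑ y with I y L, w y = 0) → ∀ x,
      ∑ y, r ^ δ x y * w y = (1 + (Q ^ 2 + Q + 1) / s + (Q * (Q ^ 2 + Q + 1)) / s ^ 2 +
        Q ^ 3 / s ^ 3) * w x := by
    intro w hw x
    rw [h.sum_radial_mul (lam := -1) (fun L z hz => sum_ne_eq_neg_of_sum_eq_zero (hw L) hz) x
      (fun i => r ^ i)]
    congr 1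
    rw [hr]
    field_simp
  refine sum_pow_three_eq_zero_of_sum_pow_three_entries_eq_zero (E := fun x y => r ^ δ x y)
    (by positivity) (fun x y => ?_) (Finset.sum_eq_zero fun x _ => ?_) (fun x => heig v hv x)
  · have := heig (fun a => r ^ δ y a) (hrow y) x
    rw [this, h.symm y x]
  · have := h.sum_radial_mul (w := fun _ => 1) (lam := s)
      (fun L z hz => by rw [hcard L z hz, mul_one]) x (fun i => (r ^ i) ^ 3)
    simp only [mul_one] at this
    rw [this, hr]
    rcases hQ with rfl | rfl <;> push_cast <;> field_simp <;> ring

open Classical in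
/-- Double counting incident pairs. -/
theorem IsRegularNearHexagon.sum_eq_zero {P Λ : Type*} [Fintype P] [Fintype Λ]
    {I : P → Λ → Prop} {δ : P → P → ℕ} {s Q : ℕ} (h : IsRegularNearHexagon I δ s Q)
    {v : P → ℝ} (hv : ∀ L, ∑ y with I y L, v y = 0) : ∑ x, v x = 0 := by
  have h1 : ∑ L, ∑ y with I y L, v y = ∑ y, ∑ L with I y L, v y :=
    Finset.sum_comm' fun L y => by simp
  have h2 : ∀ y, ∑ L with I y L, v y = (1 + Q + Q ^ 2) * v y := by
    intro y
    have h3 := h.card_point y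
    rw [Set.ncard_eq_toFinset_card', Set.toFinset_ofPred] at h3
    rw [Finset.sum_const, h3, nsmul_eq_mul]
    simp [Finset.sum_range_succ]
  simp_rw [h2, hv, ← Finset.mul_sum, Finset.sum_const_zero] at h1
  exact (mul_eq_zero.1 h1.symm).resolve_left (by positivity)

open Classical in
/-- Up to scaling, `(s + 1) 1_O - m` sums to zero on each line and takes the values `s + 1 - m` and
`-m`; its sum and the sum of its cubes can only both vanish if these values are opposite. -/
theorem IsRegularNearHexagon.two_mul_eq {P Λ : Type*} [Finite P] [Finite Λ]
    {I : P → Λ → Prop} {δ : P → P → ℕ} {s Q : ℕ} (h : IsRegularNearHexagon I δ s Q) [Nonempty P]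
    (hs : 0 < s) (hQ : Q = s ∨ Q = s ^ 2) {O : Set P} {m : ℕ} (hm0 : 0 < m) (hm1 : m < s + 1)
    (hO : ∀ L, {y | y ∈ O ∧ I y L}.ncard = m) : 2 * m = s + 1 := by
  cases nonempty_fintype P
  cases nonempty_fintype Λ
  set v : P → ℝ := fun y => (s + 1) * (if y ∈ O then 1 else 0) - m with hvdef
  have hv : ∀ L, ∑ y with I y L, v y = 0 := by
    intro L
    have h1 := h.card_line L
    have h2 := hO L
    rw [Set.ncard_eq_toFinset_card', Set.toFinset_ofPred] at h1 h2
    have h3 : ((Finset.univ.filter fun y => I y L).filter fun y => y ∈ O) =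
        Finset.univ.filter fun y => y ∈ O ∧ I y L := by
      ext y
      simp [and_comm]
    rw [hvdef, Finset.sum_sub_distrib, ← Finset.mul_sum, Finset.sum_boole, h3, h2,
      Finset.sum_const, h1, nsmul_eq_mul]
    push_cast
    ring
  have e1 := h.sum_eq_zero hv
  have e3 := h.sum_pow_three_eq_zero hs hQ hv
  have hsplit : ∀ k : ℕ, ∑ x, v x ^ k = (Finset.univ.filter fun y => y ∈ O).card *
      ((s : ℝ) + 1 - m) ^ k + (Finset.univ.filter fun y => y ∉ O).card * (-(m : ℝ)) ^ k := by
    intro k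
    rw [← Finset.sum_filter_add_sum_filter_not Finset.univ (fun y => y ∈ O)]
    congr 1
    · rw [← nsmul_eq_mul, ← Finset.sum_const]
      refine Finset.sum_congr rfl fun y hy => ?_
      simp [hvdef, (Finset.mem_filter.1 hy).2]
    · rw [← nsmul_eq_mul, ← Finset.sum_const]
      refine Finset.sum_congr rfl fun y hy => ?_
      simp [hvdef, (Finset.mem_filter.1 hy).2]
  have s0 := hsplit 0
  have s1 := hsplit 1
  have s3 := hsplit 3
  simp only [pow_zero, pow_one, mul_one] at s0 s1
  rw [e1] at s1
  rw [e3] at s3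
  have hpos : (0 : ℝ) < ∑ _x : P, (1 : ℝ) := by
    simp [Fintype.card_pos]
  rw [s0] at hpos
  set a : ℝ := ((Finset.univ.filter fun y => y ∈ O).card : ℝ)
  set b : ℝ := ((Finset.univ.filter fun y => y ∉ O).card : ℝ)
  have hm : (0 : ℝ) < m := by exact_mod_cast hm0
  have hα : (0 : ℝ) < (s : ℝ) + 1 - m := by
    have : (m : ℝ) < s + 1 := by exact_mod_cast hm1
    linarith
  have hb : b ≠ 0 := by
    intro hb
    rw [hb] at s1 hpos
    have : a * ((s : ℝ) + 1 - m) = 0 := by linarith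
    rcases mul_eq_zero.1 this with h4 | h4 <;> linarith
  have h5 : b * m * (((s : ℝ) + 1 - m) ^ 2 - m ^ 2) = 0 := by
    linear_combination -s3 + ((s : ℝ) + 1 - m) ^ 2 * s1
  have h6 := (mul_eq_zero.1 h5).resolve_left (mul_ne_zero hb hm.ne')
  have h7 : ((s : ℝ) + 1 - 2 * m) * (s + 1) = 0 := by linear_combination h6
  have h8 := (mul_eq_zero.1 h7).resolve_right (by positivity)
  have h9 : ((2 * m : ℕ) : ℝ) = ((s + 1 : ℕ) : ℝ) := by
    push_cast
    linarith
  exact_mod_cast h9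

/-! ### Subspaces of finite-dimensional spaces -/

theorem Submodule.finrank_sup_span_singleton_le {F V : Type*} [Field F] [AddCommGroup V]
    [Module F V] [FiniteDimensional F V] (A : Submodule F V) (v : V) :
    Module.finrank F ↥(A ⊔ F ∙ v) ≤ Module.finrank F A + 1 := by
  have h4 := Submodule.finrank_add_le_finrank_add_finrank A (F ∙ v)
  have h5 := finrank_span_le_card (R := F) ({v} : Set V)
  simp only [Set.toFinset_singleton, Finset.card_singleton] at h5
  omega

/-- A vector outside the hyperplane `L` of `M` spans `M` together with `L`. -/
theorem CovBy.exists_sup_span_singleton_eq {F V : Type*} [Field F] [AddCommGroup V]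
    [Module F V] {L M : Submodule F V} (h : L ⋖ M) : ∃ e ∈ M, e ∉ L ∧ L ⊔ F ∙ e = M := by
  obtain ⟨x, hxM, hxL⟩ := SetLike.exists_of_lt h.lt
  refine ⟨x, hxM, hxL, ?_⟩
  have h1 : L < L ⊔ F ∙ x := by
    refine lt_of_le_of_ne le_sup_left fun h2 => hxL ?_
    rw [h2]
    exact Submodule.mem_sup_right (Submodule.mem_span_singleton_self x)
  have hle : L ⊔ F ∙ x ≤ M := sup_le h.le ((Submodule.span_singleton_le_iff_mem _ _).2 hxM)
  exact hle.eq_of_not_lt (h.2 h1)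

theorem Submodule.exists_mem_notMem_of_finrank_lt {F V : Type*} [Field F] [AddCommGroup V]
    [Module F V] [FiniteDimensional F V] {A C : Submodule F V}
    (h : Module.finrank F A < Module.finrank F C) : ∃ v ∈ C, v ∉ A := by
  by_contra! h1
  exact h.not_ge (Submodule.finrank_mono h1)

theorem Submodule.eq_of_smul_sub_smul_mem {F V : Type*} [Field F] [AddCommGroup V] [Module F V]
    {L : Submodule F V} {e : V} (he : e ∉ L) {a b : F} (h : a • e - b • e ∈ L) : a = b := by
  by_contra hne
  rw [← sub_smul] at h
  exact he ((L.smul_mem_iff (sub_ne_zero.2 hne)).1 h)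

theorem Submodule.covBy_iff_finrank_eq {F V : Type*} [Field F] [AddCommGroup V] [Module F V]
    [FiniteDimensional F V] {L M : Submodule F V} :
    L ⋖ M ↔ L ≤ M ∧ Module.finrank F M = Module.finrank F L + 1 := by
  constructor
  · intro h
    refine ⟨h.le, ?_⟩
    obtain ⟨x, -, -, hx⟩ := h.exists_sup_span_singleton_eq
    have h1 := Submodule.finrank_lt_finrank_of_lt h.lt
    have h2 := Submodule.finrank_sup_span_singleton_le L x
    rw [hx] at h2
    omega
  · rintro ⟨h1, h2⟩
    refine ⟨lt_of_le_of_ne h1 fun h => ?_, fun N h3 h4 => ?_⟩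
    · rw [h] at h2; omega
    · have := Submodule.finrank_lt_finrank_of_lt h3
      have := Submodule.finrank_lt_finrank_of_lt h4
      omega

/-- The coatoms of `Submodule F W` correspond to the points of the projective space of the dual. -/
theorem Submodule.card_isCoatom {F W : Type*} [Field F] [Finite F] [AddCommGroup W] [Module F W]
    [FiniteDimensional F W] :
    Nat.card {N : Submodule F W // IsCoatom N} =
      ∑ j ∈ Finset.range (Module.finrank F W), Nat.card F ^ j := by
  rw [← Subspace.dual_finrank_eq, ← Projectivization.card_of_finrank F (Module.Dual F W) rfl]
  refine Nat.card_congr ((Equiv.subtypeEquiv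
    ((Subspace.orderIsoFiniteDimensional (K := F) (V := W)).toEquiv.trans OrderDual.ofDual)
    (q := fun H : Submodule F (Module.Dual F W) => Module.finrank F H = 1) fun N => ?_).trans
      (Projectivization.equivSubmodule F (Module.Dual F W)).symm)
  rw [← Submodule.isAtom_iff_finrank_eq_one, ← OrderIso.isCoatom_iff
    (Subspace.orderIsoFiniteDimensional (K := F) (V := W))]
  rfl

theorem Submodule.ncard_covBy {F V : Type*} [Field F] [Finite F] [AddCommGroup V] [Module F V]
    [FiniteDimensional F V] {K M : Submodule F V} (hK : K ≤ M) :
    {L : Submodule F V | K ≤ L ∧ L ⋖ M}.ncard =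
      ∑ j ∈ Finset.range (Module.finrank F M - Module.finrank F K), Nat.card F ^ j := by
  set K' : Submodule F M := K.comap M.subtype
  let f : Submodule F (M ⧸ K') → Submodule F V := fun N => (N.comap K'.mkQ).map M.subtype
  have hf : Function.Injective f := fun N N' h =>
    Submodule.comap_injective_of_surjective K'.mkQ_surjective
      (Submodule.map_injective_of_injective M.injective_subtype h)
  have himage : {L : Submodule F V | K ≤ L ∧ L ⋖ M} = f '' {N | IsCoatom N} := by
    ext L
    constructor
    · rintro ⟨h1, h2⟩
      have h3 : IsCoatom (L.comap M.subtype) := by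
        rw [← OrderIso.isCoatom_iff M.mapIic, Set.Iic.isCoatom_iff, Submodule.coe_mapIic_apply,
          Submodule.map_comap_subtype, inf_eq_right.2 h2.le]
        exact h2
      refine ⟨(L.comap M.subtype).map K'.mkQ, ?_, ?_⟩
      · refine Submodule.isCoatom_map_of_ker_le K'.mkQ_surjective ?_ h3
        rw [Submodule.ker_mkQ]
        exact Submodule.comap_mono h1
      · simp only [f]
        rw [Submodule.comap_map_mkQ, sup_eq_right.2 (Submodule.comap_mono h1),
          Submodule.map_comap_subtype, inf_eq_right.2 h2.le]
    · rintro ⟨N, hN, rfl⟩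
      constructor
      · have h1 : K' ≤ N.comap K'.mkQ := fun x hx => by
          have h2 : K'.mkQ x = 0 := by simpa using hx
          simp [Submodule.mem_comap, h2]
        intro x hx
        exact ⟨⟨x, hK hx⟩, h1 hx, rfl⟩
      · have h1 := (Submodule.isCoatom_comap_iff K'.mkQ_surjective).2 hN
        rw [← OrderIso.isCoatom_iff M.mapIic, Set.Iic.isCoatom_iff] at h1
        exact h1
  rw [himage, Set.ncard_image_of_injective _ hf]
  have h1 := Submodule.card_isCoatom (F := F) (W := M ⧸ K')
  have h2 := Submodule.finrank_quotient_add_finrank K'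
  have h3 : Module.finrank F K' = Module.finrank F K :=
    (Submodule.comapSubtypeEquivOfLe hK).finrank_eq
  rw [← Nat.card_coe_set_eq]
  refine h1.trans ?_
  rw [← h2, h3, Nat.add_sub_cancel]

/-- Enlarging `A` to `L` lowers the dimension of the orthogonal complement, even relative to a
subspace `W`, by at most the difference of the dimensions. -/
theorem Submodule.finrank_inf_orthogonalBilin_add_le {F V : Type*} [Field F] [AddCommGroup V]
    [Module F V] [FiniteDimensional F V] {σ : F →+* F} (B : V →ₛₗ[σ] V →ₗ[F] F)
    (W : Submodule F V) {A L : Submodule F V} (hAL : A ≤ L) :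
    Module.finrank F ↥(W ⊓ A.orthogonalBilin B) + Module.finrank F A ≤
      Module.finrank F ↥(W ⊓ L.orthogonalBilin B) + Module.finrank F L := by
  obtain ⟨C, hC⟩ := exists_isCompl (A.comap L.subtype)
  let c := Module.finBasis F C
  let g : ↥(W ⊓ A.orthogonalBilin B) →ₗ[F] (Fin (Module.finrank F C) → F) :=
    LinearMap.pi fun i => (B ((c i : L) : V)).comp (W ⊓ A.orthogonalBilin B).subtype
  have hker : (LinearMap.ker g).map (W ⊓ A.orthogonalBilin B).subtype ≤
      W ⊓ L.orthogonalBilin B := by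
    rintro _ ⟨⟨x, hxW, hxA⟩, hx, rfl⟩
    refine ⟨hxW, fun n hn => ?_⟩
    have hC0 : ∀ y : C, B ((y : L) : V) x = 0 := by
      intro y
      have h1 : ∀ i, B ((c i : L) : V) x = 0 := fun i => congrFun hx i
      refine Submodule.span_induction (p := fun (y : C) _ => B ((y : L) : V) x = 0) ?_ ?_ ?_ ?_
        (c.mem_span y)
      · rintro _ ⟨i, rfl⟩
        exact h1 i
      · simp
      · intro a b _ _ ha hb
        simp [ha, hb]
      · intro a b _ hb
        simp [hb]
    obtain ⟨a, ha, b, hb, hab⟩ : ∃ a ∈ A.comap L.subtype, ∃ b ∈ C, a + b = (⟨n, hn⟩ : L) := by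
      rw [← Submodule.mem_sup, hC.sup_eq_top]
      trivial
    have h2 : n = (a : V) + (b : V) := by
      rw [← Submodule.coe_add, hab]
    have h3 : B (a : V) x = 0 := hxA a ha
    change B n x = 0
    rw [h2, map_add, LinearMap.add_apply, h3, hC0 ⟨b, hb⟩, add_zero]
  have h1 := LinearMap.finrank_range_add_finrank_ker g
  have h2 := Submodule.finrank_le (LinearMap.range g)
  have h3 := Submodule.finrank_mono hker
  rw [LinearEquiv.finrank_eq
    ((LinearMap.ker g).equivMapOfInjective _ (Submodule.injective_subtype _)).symm] at h3
  have h4 := Submodule.finrank_add_eq_of_isCompl hC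
  rw [(Submodule.comapSubtypeEquivOfLe hAL).finrank_eq] at h4
  simp only [Module.finrank_fin_fun] at h2
  omega

theorem Submodule.mem_orthogonalBilin_sup_span_singleton {F V : Type*} [Field F] [AddCommGroup V]
    [Module F V] {σ : F →+* F} {B : V →ₛₗ[σ] V →ₗ[F] F} {L : Submodule F V} {e y : V}
    (hy : y ∈ L.orthogonalBilin B) (hey : B e y = 0) : y ∈ (L ⊔ F ∙ e).orthogonalBilin B := by
  intro n hn
  obtain ⟨l, hl, w, hw, rfl⟩ := Submodule.mem_sup.1 hn
  obtain ⟨a, rfl⟩ := Submodule.mem_span_singleton.1 hw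
  have h6 : B l y = 0 := hy l hl
  simp [hey, h6]

/-! ### Totally singular subspaces -/

/-- The totally singular subspaces of a polarity: `S` is a predicate on subspaces behaving as "all
vectors are singular and pairwise orthogonal" with respect to the reflexive sesquilinear form `B`.
Nondegeneracy is only asked for on the totally singular subspaces, so that the polar form of a
nondegenerate quadratic form in odd dimension and characteristic two is allowed. -/
structure IsPolarSystem {F V : Type*} [Field F] [AddCommGroup V] [Module F V] {σ : F →+* F}
    (S : Submodule F V → Prop) (B : V →ₛₗ[σ] V →ₗ[F] F) : Prop where
  mono : ∀ {W W' : Submodule F V}, W ≤ W' → S W' → S W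
  le_orthogonal : ∀ {W : Submodule F V}, S W → W ≤ W.orthogonalBilin B
  sup : ∀ {A C : Submodule F V}, S A → S C → C ≤ A.orthogonalBilin B → S (A ⊔ C)
  isRefl : B.IsRefl
  inf_radical : ∀ {W : Submodule F V}, S W →
    W ⊓ (⊤ : Submodule F V).orthogonalBilin B = ⊥

namespace IsPolarSystem

variable {F V : Type*} [Field F] [AddCommGroup V] [Module F V] {σ : F →+* F}
  {S : Submodule F V → Prop} {B : V →ₛₗ[σ] V →ₗ[F] F}

theorem le_of_le_orthogonal (h : IsPolarSystem S B) {M N : Submodule F V} (hM : Maximal S M)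
    (hN : S N) (hNM : N ≤ M.orthogonalBilin B) : N ≤ M :=
  le_sup_right.trans (hM.2 (h.sup hM.1 hN hNM) le_sup_left)

theorem mem_of_mem_orthogonal (h : IsPolarSystem S B) {M : Submodule F V} (hM : Maximal S M)
    {v : V} (hv : v ∈ M.orthogonalBilin B) (hS : S (F ∙ v)) : v ∈ M :=
  (Submodule.span_singleton_le_iff_mem _ _).1 (h.le_of_le_orthogonal hM hS
    ((Submodule.span_singleton_le_iff_mem _ _).2 hv))

theorem finrank_orthogonal_add [FiniteDimensional F V] (h : IsPolarSystem S B)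
    {W : Submodule F V} (hW : S W) :
    Module.finrank F (W.orthogonalBilin B) + Module.finrank F W = Module.finrank F V := by
  have h1 := Submodule.finrank_inf_orthogonalBilin_add_le B ⊤ (bot_le : ⊥ ≤ W)
  have h2 := Submodule.finrank_inf_orthogonalBilin_add_le B W
    (le_top : W.orthogonalBilin B ≤ ⊤)
  rw [inf_eq_left.2 (Submodule.le_orthogonalBilin_orthogonalBilin h.isRefl), h.inf_radical hW] at h2
  have h3 : (⊥ : Submodule F V).orthogonalBilin B = ⊤ := by
    rw [eq_top_iff]
    rintro x - n hn
    rw [(Submodule.mem_bot F).1 hn, map_zero, LinearMap.zero_apply]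
  rw [h3, top_inf_eq, top_inf_eq] at h1
  simp only [finrank_top, finrank_bot] at h1 h2
  omega

theorem orthogonal_eq_self [FiniteDimensional F V] (h : IsPolarSystem S B) {M : Submodule F V}
    (hM : S M) (hV : Module.finrank F V = 2 * Module.finrank F M) : M.orthogonalBilin B = M := by
  have h1 := h.finrank_orthogonal_add hM
  exact (Submodule.eq_of_le_of_finrank_le (h.le_orthogonal hM) (by omega)).symm

/-- A maximal totally singular subspace has the largest dimension. -/
theorem finrank_le [FiniteDimensional F V] (h : IsPolarSystem S B) {M N : Submodule F V}
    (hM : Maximal S M) (hN : S N) : Module.finrank F N ≤ Module.finrank F M := by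
  have h1 := Submodule.finrank_inf_orthogonalBilin_add_le B N (inf_le_left : M ⊓ N ≤ M)
  have h2 : N ≤ (M ⊓ N).orthogonalBilin B :=
    (h.le_orthogonal hN).trans (Submodule.orthogonalBilin_le inf_le_right)
  rw [inf_eq_left.2 h2] at h1
  have h3 : N ⊓ M.orthogonalBilin B ≤ M ⊓ N :=
    le_inf (h.le_of_le_orthogonal hM (h.mono inf_le_left hN) inf_le_right) inf_le_left
  have h4 := Submodule.finrank_mono h3
  omega

theorem maximal_of_finrank_eq [FiniteDimensional F V] (h : IsPolarSystem S B)
    {M N : Submodule F V} (hM : Maximal S M) (hN : S N)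
    (hNM : Module.finrank F N = Module.finrank F M) : Maximal S N :=
  ⟨hN, fun _ hW hle => (Submodule.eq_of_le_of_finrank_le hle
    ((h.finrank_le hM hW).trans hNM.ge)).ge⟩

theorem two_mul_finrank_le [FiniteDimensional F V] (h : IsPolarSystem S B)
    {W : Submodule F V} (hW : S W) : 2 * Module.finrank F W ≤ Module.finrank F V := by
  have h1 := h.finrank_orthogonal_add hW
  have h2 := Submodule.finrank_mono (h.le_orthogonal hW)
  omega

/-- The near polygon axiom: on each line `L` there is a unique point nearest to `x`, namely the
span of `L` and the part of `x` orthogonal to `L`. -/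
theorem exists_gate [FiniteDimensional F V] (h : IsPolarSystem S B) {x L : Submodule F V}
    (hx : Maximal S x) (hL : S L) (hLx : Module.finrank F x = Module.finrank F L + 1) :
    ∃ z, Maximal S z ∧ L ≤ z ∧
      Module.finrank F ↥(x ⊓ z) = Module.finrank F ↥(x ⊓ L) + 1 ∧
      ∀ y, Maximal S y → L ≤ y → y ≠ z → x ⊓ y = x ⊓ L := by
  set A : Submodule F V := x ⊓ L.orthogonalBilin B with hA
  have hxL : x ⊓ L ≤ A := le_inf inf_le_left (inf_le_right.trans (h.le_orthogonal hL))
  have h1 : Module.finrank F ↥(x ⊓ L) + 1 ≤ Module.finrank F A := by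
    have h2 := Submodule.finrank_inf_orthogonalBilin_add_le B x (inf_le_right : x ⊓ L ≤ L)
    have h3 : x ≤ (x ⊓ L).orthogonalBilin B :=
      (h.le_orthogonal hx.1).trans (Submodule.orthogonalBilin_le inf_le_left)
    rw [inf_eq_left.2 h3, ← hA] at h2
    omega
  have hS : S (L ⊔ A) := h.sup hL (h.mono inf_le_left hx.1) inf_le_right
  have h2 := Submodule.finrank_sup_add_finrank_inf_eq L A
  have h3 : L ⊓ A = x ⊓ L :=
    le_antisymm (le_inf (inf_le_right.trans inf_le_left) inf_le_left) (le_inf inf_le_right hxL)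
  rw [h3] at h2
  have h4 := h.finrank_le hx hS
  have hmax : Maximal S (L ⊔ A) := h.maximal_of_finrank_eq hx hS (by omega)
  have hle : ∀ y, S y → L ≤ y → x ⊓ y ≤ A := fun y hy hLy =>
    inf_le_inf_left x ((h.le_orthogonal hy).trans (Submodule.orthogonalBilin_le hLy))
  refine ⟨L ⊔ A, hmax, le_sup_left, ?_, ?_⟩
  · have h5 : x ⊓ (L ⊔ A) = A :=
      le_antisymm (hle _ hS le_sup_left) (le_inf inf_le_left le_sup_right)
    rw [h5]
    omega
  · intro y hy hLy hne
    by_contra hne'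
    have h5 : x ⊓ L ≤ x ⊓ y := inf_le_inf_left x hLy
    have h6 := Submodule.finrank_lt_finrank_of_lt (lt_of_le_of_ne h5 (Ne.symm hne'))
    have h7 : x ⊓ y = A := Submodule.eq_of_le_of_finrank_le (hle y hy.1 hLy) (by omega)
    have h8 : L ⊔ A ≤ y := sup_le hLy (h7 ▸ inf_le_right)
    exact hne (hmax.eq_of_le hy.1 h8).symm

/-- If `L` is a hyperplane of a totally singular subspace, spanned together with `L` by `e`, then
some `f` is orthogonal to `L` and forms with `e` a pair of product one. -/
theorem exists_apply_eq_one [FiniteDimensional F V] (h : IsPolarSystem S B)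
    {L M : Submodule F V} (hM : S M) (hLM : L ⋖ M) {e : V} (he : L ⊔ F ∙ e = M) :
    ∃ f ∈ L.orthogonalBilin B, B e f = 1 := by
  have h1 := h.finrank_orthogonal_add hM
  have h2 := h.finrank_orthogonal_add (h.mono hLM.le hM)
  have h3 := (Submodule.covBy_iff_finrank_eq.1 hLM).2
  have h4 : M.orthogonalBilin B < L.orthogonalBilin B := by
    refine lt_of_le_of_ne (Submodule.orthogonalBilin_le hLM.le) fun h4 => ?_
    rw [h4] at h1
    omega
  obtain ⟨f, hf, hfM⟩ := SetLike.exists_of_lt h4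
  have h5 : B e f ≠ 0 := by
    intro h5
    refine hfM fun n hn => ?_
    rw [← he] at hn
    obtain ⟨l, hl, y, hy, rfl⟩ := Submodule.mem_sup.1 hn
    obtain ⟨a, rfl⟩ := Submodule.mem_span_singleton.1 hy
    have h6 : B l f = 0 := hf l hl
    simp [h5, h6]
  exact ⟨(B e f)⁻¹ • f, Submodule.smul_mem _ _ hf, by simp [h5]⟩

/-- The points on a line `L` other than a given one `L ⊔ ⟨e⟩` correspond to the classes modulo `L`
of the singular vectors in the orthogonal complement of `L` that have product one with `e`; the
family `z` is a system of representatives. -/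
theorem ncard_maximal_ge [FiniteDimensional F V] [Finite V] (h : IsPolarSystem S B)
    {L M : Submodule F V} (hM : Maximal S M) (hLM : L ⋖ M) {e : V} (he : L ⊔ F ∙ e = M)
    {T : Type*} [Finite T] (z : T → V) (hz : ∀ t, z t ∈ L.orthogonalBilin B)
    (hez : ∀ t, B e (z t) = 1) (hSz : ∀ t, S (F ∙ z t))
    (hinj : ∀ t t', z t - z t' ∈ L → t = t')
    (hsurj : ∀ y ∈ L.orthogonalBilin B, B e y = 1 → S (F ∙ y) → ∃ t, y - z t ∈ L) :
    {N | Maximal S N ∧ L ≤ N}.ncard = Nat.card T + 1 := by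
  have heM : e ∈ M := he ▸ Submodule.mem_sup_right (Submodule.mem_span_singleton_self e)
  have hSL : S L := h.mono hLM.le hM.1
  have hzM : ∀ t, z t ∉ M := fun t ht => one_ne_zero ((hez t).symm.trans
    (h.le_orthogonal hM.1 ht e heM))
  have hzmem : ∀ t, z t ∈ L ⊔ F ∙ z t := fun t =>
    Submodule.mem_sup_right (Submodule.mem_span_singleton_self _)
  have hmax : ∀ t, Maximal S (L ⊔ F ∙ z t) := by
    intro t
    have hS : S (L ⊔ F ∙ z t) :=
      h.sup hSL (hSz t) ((Submodule.span_singleton_le_iff_mem _ _).2 (hz t))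
    have h1 : L < L ⊔ F ∙ z t := lt_of_le_of_ne le_sup_left fun h2 =>
      hzM t (hLM.le (h2.symm ▸ hzmem t))
    have h2 := Submodule.finrank_lt_finrank_of_lt h1
    have h3 := (Submodule.covBy_iff_finrank_eq.1 hLM).2
    have h4 := h.finrank_le hM hS
    exact h.maximal_of_finrank_eq hM hS (by omega)
  have hset : {N | Maximal S N ∧ L ≤ N} = insert M (Set.range fun t => L ⊔ F ∙ z t) := by
    ext N
    constructor
    · rintro ⟨hN, hLN⟩
      by_cases hNM : N = M
      · exact Or.inl hNM
      · refine Or.inr ?_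
        have h1 : ∃ y ∈ N, B e y ≠ 0 := by
          by_contra! h2
          have h3 : F ∙ e ≤ N := by
            refine h.le_of_le_orthogonal hN
              (h.mono ((Submodule.span_singleton_le_iff_mem _ _).2 heM) hM.1) ?_
            rw [Submodule.span_singleton_le_iff_mem]
            exact fun n hn => h.isRefl _ _ (h2 n hn)
          exact hNM (hM.eq_of_le hN.1 (he ▸ sup_le hLN h3)).symm
        obtain ⟨y, hy, hey⟩ := h1
        have hy' : (B e y)⁻¹ • y ∈ N := N.smul_mem _ hy
        obtain ⟨t, ht⟩ := hsurj ((B e y)⁻¹ • y)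
          ((h.le_orthogonal hN.1).trans (Submodule.orthogonalBilin_le hLN) hy') (by simp [hey])
          (h.mono ((Submodule.span_singleton_le_iff_mem _ _).2 hy') hN.1)
        have h2 : z t ∈ N := by
          have := N.sub_mem hy' (hLN ht)
          rwa [sub_sub_cancel] at this
        exact ⟨t, (hmax t).eq_of_le hN.1
          (sup_le hLN ((Submodule.span_singleton_le_iff_mem _ _).2 h2))⟩
    · rintro (rfl | ⟨t, rfl⟩)
      · exact ⟨hM, hLM.le⟩
      · exact ⟨hmax t, le_sup_left⟩
  have hnot : M ∉ Set.range fun t => L ⊔ F ∙ z t := by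
    rintro ⟨t, ht⟩
    exact hzM t (ht ▸ hzmem t)
  have hinj' : Function.Injective fun t => L ⊔ F ∙ z t := by
    intro t t' htt'
    have h1 : z t ∈ L ⊔ F ∙ z t' := by
      have := hzmem t
      rwa [show L ⊔ F ∙ z t = L ⊔ F ∙ z t' from htt'] at this
    obtain ⟨l, hl, y, hy, hly⟩ := Submodule.mem_sup.1 h1
    obtain ⟨a, rfl⟩ := Submodule.mem_span_singleton.1 hy
    have h2 : B e l = 0 := h.le_orthogonal hM.1 (hLM.le hl) e heM
    have h3 := hez t
    rw [← hly, map_add, map_smul, h2, hez t', smul_eq_mul, mul_one, zero_add] at h3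
    refine hinj t t' ?_
    rw [← hly, h3, one_smul, add_sub_cancel_right]
    exact hl
  rw [hset, Set.ncard_insert_of_notMem hnot (Set.finite_range _), ← Set.image_univ,
    Set.ncard_image_of_injective _ hinj', Set.ncard_univ]

/-- The maximal totally singular subspaces through a totally singular subspace `U` of codimension
three in the maximal ones form a regular near hexagon; the distance of two of them is the
codimension of their intersection. -/
theorem isRegularNearHexagon [Finite F] [FiniteDimensional F V] [Finite V]
    (h : IsPolarSystem S B) {d s : ℕ} (hd : ∀ M, Maximal S M → Module.finrank F M = d)
    (hs : ∀ L M, Maximal S M → L ⋖ M → {N | Maximal S N ∧ L ≤ N}.ncard = s + 1)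
    {U : Submodule F V} (hU : Module.finrank F U + 3 = d) :
    IsRegularNearHexagon
      (P := {M : Submodule F V // Maximal S M ∧ U ≤ M})
      (Λ := {L : Submodule F V // (S L ∧ ∃ M, Maximal S M ∧ L ⋖ M) ∧ U ≤ L})
      (fun M L => L.1 ≤ M.1) (fun M N => d - Module.finrank F ↥(M.1 ⊓ N.1)) s (Nat.card F) := by
  have hle : ∀ x y : Submodule F V, Maximal S x → Module.finrank F ↥(x ⊓ y) ≤ d := fun x y hx =>
    (Submodule.finrank_mono inf_le_left).trans (hd x hx).le
  have hgate : ∀ x L : Submodule F V, Maximal S x → (S L ∧ ∃ M, Maximal S M ∧ L ⋖ M) →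
      ∃ z, Maximal S z ∧ L ≤ z ∧
        Module.finrank F ↥(x ⊓ z) = Module.finrank F ↥(x ⊓ L) + 1 ∧
        ∀ y, Maximal S y → L ≤ y → y ≠ z → x ⊓ y = x ⊓ L := by
    rintro x L hx ⟨hL, M, hM, hLM⟩
    refine h.exists_gate hx hL ?_
    rw [hd x hx, ← hd M hM]
    exact (Submodule.covBy_iff_finrank_eq.1 hLM).2
  have hcov : ∀ L y : Submodule F V, (S L ∧ ∃ M, Maximal S M ∧ L ⋖ M) → Maximal S y → L ≤ y →
      L ⋖ y := by
    rintro L y ⟨hL, M, hM, hLM⟩ hy hLy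
    refine Submodule.covBy_iff_finrank_eq.2 ⟨hLy, ?_⟩
    rw [hd y hy, ← hd M hM]
    exact (Submodule.covBy_iff_finrank_eq.1 hLM).2
  refine ⟨?_, ?_, ?_, ?_, ?_, ?_, ?_⟩
  · intro x y
    rw [inf_comm]
  · rintro ⟨x, hx, hUx⟩ ⟨y, hy, hUy⟩
    simp only [Subtype.mk.injEq]
    constructor
    · intro h1
      have h2 := hle x y hx
      have h3 : x ⊓ y = x := Submodule.eq_of_le_of_finrank_le inf_le_left (by rw [hd x hx]; omega)
      exact hx.eq_of_le hy.1 (inf_eq_left.1 h3)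
    · rintro rfl
      rw [inf_idem, hd x hx, Nat.sub_self]
  · rintro ⟨x, hx, hUx⟩ ⟨y, hy, hUy⟩
    have h1 := Submodule.finrank_mono (le_inf hUx hUy)
    dsimp only
    omega
  · rintro ⟨x, hx, hUx⟩ ⟨L, hL, hUL⟩
    obtain ⟨z, hz, hLz, hxz, hu⟩ := hgate x L hx hL
    refine ⟨⟨z, hz, hUL.trans hLz⟩, hLz, ?_⟩
    rintro ⟨y, hy, hUy⟩ hLy hne
    have h1 := hu y hy hLy fun h2 => hne (Subtype.ext h2)
    have h2 := hle x z hx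
    dsimp only
    rw [h1]
    omega
  · rintro ⟨L, hL, hUL⟩
    obtain ⟨-, M, hM, hLM⟩ := hL
    rw [← hs L M hM hLM, ← Set.ncard_image_of_injective _ Subtype.val_injective]
    congr 1
    ext N
    constructor
    · rintro ⟨⟨N, hN, hUN⟩, hLN, rfl⟩
      exact ⟨hN, hLN⟩
    · rintro ⟨hN, hLN⟩
      exact ⟨⟨N, hN, hUL.trans hLN⟩, hLN, rfl⟩
  · rintro ⟨y, hy, hUy⟩
    rw [show 3 = Module.finrank F y - Module.finrank F U by rw [hd y hy]; omega,
      ← Submodule.ncard_covBy hUy, ← Set.ncard_image_of_injective _ Subtype.val_injective]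
    congr 1
    ext L
    constructor
    · rintro ⟨⟨L, hL, hUL⟩, hLy, rfl⟩
      exact ⟨hUL, hcov L y hL hy hLy⟩
    · rintro ⟨hUL, hLy⟩
      exact ⟨⟨L, ⟨h.mono hLy.le hy.1, y, hy, hLy⟩, hUL⟩, hLy.le, rfl⟩
  · rintro ⟨x, hx, hUx⟩ ⟨y, hy, hUy⟩
    dsimp only
    rw [← hd y hy, ← Submodule.ncard_covBy (inf_le_right : x ⊓ y ≤ y),
      ← Set.ncard_image_of_injective _ Subtype.val_injective]
    congr 1
    ext L
    constructor
    · rintro ⟨⟨L, hL, hUL⟩, ⟨hLy, ⟨w, hw, hUw⟩, hLw, hwy⟩, rfl⟩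
      refine ⟨?_, hcov L y hL hy hLy⟩
      dsimp only at hLy hLw hwy ⊢
      obtain ⟨z, hz, hLz, hxz, hu⟩ := hgate x L hx hL
      have h1 : Module.finrank F ↥(x ⊓ w) ≤ Module.finrank F ↥(x ⊓ L) + 1 := by
        by_cases hwz : w = z
        · rw [hwz, hxz]
        · rw [hu w hw hLw hwz]; omega
      have h2 : x ⊓ L ≤ x ⊓ y := inf_le_inf_left x hLy
      have h3 := hle x y hx
      have h4 := hle x w hx
      have h5 := hd y hy
      have h6 : x ⊓ L = x ⊓ y := Submodule.eq_of_le_of_finrank_le h2 (by omega)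
      exact h6 ▸ inf_le_right
    · rintro ⟨hxy, hLy⟩
      have hL : S L ∧ ∃ M, Maximal S M ∧ L ⋖ M := ⟨h.mono hLy.le hy.1, y, hy, hLy⟩
      have hUL : U ≤ L := (le_inf hUx hUy).trans hxy
      obtain ⟨z, hz, hLz, hxz, -⟩ := hgate x L hx hL
      have h1 : x ⊓ L = x ⊓ y := le_antisymm (inf_le_inf_left x hLy.le) (le_inf inf_le_left hxy)
      refine ⟨⟨L, hL, hUL⟩, ⟨hLy.le, ⟨z, hz, hUL.trans hLz⟩, hLz, ?_⟩, rfl⟩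
      have h2 := hle x z hx
      have h3 := hd y hy
      dsimp only
      rw [h1] at hxz
      omega

/-- An `m`-ovoid restricts to an `m`-ovoid of the near hexagon at a subspace of codimension three,
and as it is nontrivial, `0 < m < s + 1`. -/
theorem isHemisystem [Finite F] [FiniteDimensional F V] [Finite V]
    (h : IsPolarSystem S B) {d s : ℕ} (hd3 : 3 ≤ d)
    (hd : ∀ M, Maximal S M → Module.finrank F M = d)
    (hs : ∀ L M, Maximal S M → L ⋖ M → {N | Maximal S N ∧ L ≤ N}.ncard = s + 1)
    (hs0 : 0 < s) (hF : Nat.card F = s ∨ Nat.card F = s ^ 2)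
    {m : ℕ} {O : Set (dualPolarSpace S).Point} (hm : (dualPolarSpace S).IsMOvoid m O)
    (hO : (dualPolarSpace S).IsNontrivial O) :
    (dualPolarSpace S).IsHemisystem O ∧ 2 * m = s + 1 := by
  have hfin : Finite (dualPolarSpace S).Point :=
    inferInstanceAs (Finite {M : Submodule F V // Maximal S M})
  have hcard : ∀ l : (dualPolarSpace S).Line, ((dualPolarSpace S).pointsOn l).ncard = s + 1 := by
    rintro ⟨L, hL, M, hM, hLM⟩
    refine (Set.ncard_image_of_injective _ Subtype.val_injective).symm.trans
      (Eq.trans ?_ (hs L M hM hLM))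
    congr 1
    ext N
    constructor
    · rintro ⟨⟨N, hN⟩, hLN, rfl⟩
      exact ⟨hN, hLN⟩
    · rintro ⟨hN, hLN⟩
      exact ⟨⟨N, hN⟩, hLN, rfl⟩
  have hexists : ∀ M : Submodule F V, 0 < Module.finrank F M → ∃ L, L ⋖ M := by
    intro M hM
    have h1 : ⊥ < M := bot_lt_iff_ne_bot.2 fun h1 => by
      rw [h1, finrank_bot] at hM
      exact hM.false
    obtain ⟨L, -, hL⟩ := exists_le_covBy_of_lt h1
    exact ⟨L, hL⟩
  have hline : ∀ p : (dualPolarSpace S).Point, ∃ l, p ∈ (dualPolarSpace S).pointsOn l := by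
    rintro ⟨M, hM⟩
    obtain ⟨L, hL⟩ := hexists M (by rw [hd M hM]; omega)
    exact ⟨⟨L, h.mono hL.le hM.1, M, hM, hL⟩, hL.le⟩
  have hm' : ∀ l, (O ∩ (dualPolarSpace S).pointsOn l).ncard = m := fun l => by
    rw [Set.ncard_def, hm l, ENat.toNat_natCast]
  obtain ⟨p, hp⟩ := Set.nonempty_iff_ne_empty.2 hO.1
  have hm0 : 0 < m := by
    obtain ⟨l, hl⟩ := hline p
    rw [← hm' l, Set.ncard_pos]
    exact ⟨p, hp, hl⟩
  have hm1 : m < s + 1 := by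
    obtain ⟨p', hp'⟩ := (Set.ne_univ_iff_exists_notMem O).1 hO.2
    obtain ⟨l, hl⟩ := hline p'
    rw [← hm' l, ← hcard l]
    refine Set.ncard_lt_ncard ?_
    rw [Set.ssubset_iff_exists]
    exact ⟨Set.inter_subset_right, p', hl, fun h1 => hp' h1.1⟩
  have key : 2 * m = s + 1 := by
    obtain ⟨M, hM⟩ := p
    have h0 := hd M hM
    obtain ⟨L₁, hL₁⟩ := hexists M (by omega)
    have h1 := (Submodule.covBy_iff_finrank_eq.1 hL₁).2
    obtain ⟨L₂, hL₂⟩ := hexists L₁ (by omega)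
    have h2 := (Submodule.covBy_iff_finrank_eq.1 hL₂).2
    obtain ⟨U, hU⟩ := hexists L₂ (by omega)
    have h3 := (Submodule.covBy_iff_finrank_eq.1 hU).2
    have hhex := h.isRegularNearHexagon hd hs (U := U) (by omega)
    have : Nonempty {M : Submodule F V // Maximal S M ∧ U ≤ M} :=
      ⟨⟨M, hM, hU.le.trans (hL₂.le.trans hL₁.le)⟩⟩
    refine hhex.two_mul_eq hs0 hF hm0 hm1 (O := {N | (⟨N.1, N.2.1⟩ : {M // Maximal S M}) ∈ O}) ?_
    rintro ⟨L, hL, hUL⟩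
    rw [← hm' ⟨L, hL⟩, ← Set.ncard_image_of_injective _ Subtype.val_injective,
      ← Set.ncard_image_of_injective (O ∩ (dualPolarSpace S).pointsOn ⟨L, hL⟩)
        Subtype.val_injective]
    congr 1
    ext N
    constructor
    · rintro ⟨⟨N, hN, hUN⟩, ⟨hNO, hLN⟩, rfl⟩
      exact ⟨⟨N, hN⟩, ⟨hNO, hLN⟩, rfl⟩
    · rintro ⟨⟨N, hN⟩, ⟨hNO, hLN⟩, rfl⟩
      exact ⟨⟨N, hN, hUL.trans hLN⟩, ⟨hNO, hLN⟩, rfl⟩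
  refine ⟨⟨m, hm, fun l => ?_⟩, key⟩
  rw [← Set.Finite.cast_ncard_eq (Set.toFinite _), hcard l, ← key]
  push_cast
  rfl

end IsPolarSystem

/-! ### Trace and norm of a quadratic extension, zeros of quadratic forms -/

theorem Finset.card_fiber_eq_of_le {α β : Type*} [DecidableEq β] {s : Finset α} {t : Finset β}
    {f : α → β} {m n : ℕ} (hf : ∀ a ∈ s, f a ∈ t) (ht : t.card ≤ n)
    (hm : ∀ b ∈ t, (s.filter fun a => f a = b).card ≤ m) (hs : s.card = n * m) {b : β}
    (hb : b ∈ t) : (s.filter fun a => f a = b).card = m := by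
  refine le_antisymm (hm b hb) (not_lt.1 fun hlt => ?_)
  have h1 := Finset.card_eq_sum_card_fiberwise hf
  have h2 := Finset.sum_lt_sum hm ⟨b, hb, hlt⟩
  rw [← h1, hs, Finset.sum_const, smul_eq_mul] at h2
  exact h2.not_ge (Nat.mul_le_mul_right m ht)

open Polynomial in
theorem Polynomial.card_filter_eval_eq_zero_le {F : Type*} [Field F] [Fintype F] [DecidableEq F]
    {p : F[X]} (hp : p ≠ 0) : (Finset.univ.filter fun a => p.eval a = 0).card ≤ p.natDegree := by
  refine Polynomial.card_le_degree_of_subset_roots fun a ha => ?_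
  have h1 : p.eval a = 0 := by simpa using ha
  exact (Polynomial.mem_roots hp).2 h1

namespace FiniteField

theorem two_le_of_card_eq_sq {F : Type*} [Field F] [Finite F] {q : ℕ}
    (hq : Nat.card F = q ^ 2) : 2 ≤ q := by
  have h1 : 1 < Nat.card F := Finite.one_lt_card
  rw [hq] at h1
  by_contra h2
  interval_cases q <;> omega

theorem apply_apply_of_card_eq_sq {F : Type*} [Field F] [Finite F] {q : ℕ}
    (hq : Nat.card F = q ^ 2) {σ : F →+* F} (hσ : ∀ a, σ a = a ^ q) (a : F) : σ (σ a) = a := by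
  cases nonempty_fintype F
  rw [hσ, hσ, ← pow_mul, ← pow_two, ← hq, Nat.card_eq_fintype_card, FiniteField.pow_card]

open Polynomial in
/-- The trace to the subfield of order `q` takes each value of the subfield `q` times, because it
takes each value at most `q` times. -/
theorem card_add_eq {F : Type*} [Field F] [Finite F] {q : ℕ} (hq : Nat.card F = q ^ 2)
    {σ : F →+* F} (hσ : ∀ a, σ a = a ^ q) {c : F} (hc : σ c = c) :
    Nat.card {a : F // σ a + a = c} = q := by
  classical
  cases nonempty_fintype F
  have hq2 := two_le_of_card_eq_sq hq
  have hdeg : ∀ r : F[X], r.degree < q → (X ^ q + r) ≠ 0 ∧ (X ^ q + r).natDegree = q := by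
    intro r hr
    have h1 : (X ^ q + r).Monic := monic_X_pow_add (by simpa using hr)
    refine ⟨h1.ne_zero, ?_⟩
    rw [natDegree_add_eq_left_of_degree_lt, natDegree_X_pow]
    rwa [degree_X_pow]
  have hdeg1 : ((1 : ℕ) : WithBot ℕ) < q := by exact_mod_cast hq2
  have hdeg0 : ((0 : ℕ) : WithBot ℕ) < q := by exact_mod_cast (by omega : 0 < q)
  rw [Nat.card_eq_fintype_card, Fintype.card_subtype]
  refine Finset.card_fiber_eq_of_le (s := Finset.univ) (f := fun a => σ a + a)
    (t := Finset.univ.filter fun c => σ c = c) (n := q) ?_ ?_ ?_ ?_ (by simpa using hc)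
  · intro a _
    simp [apply_apply_of_card_eq_sq hq hσ, add_comm]
  · obtain ⟨h1, h2⟩ := hdeg (-X) (by rwa [degree_neg, degree_X])
    have h3 := Polynomial.card_filter_eval_eq_zero_le h1
    rw [h2] at h3
    refine le_trans (Finset.card_le_card fun a ha => ?_) h3
    simpa [hσ, add_neg_eq_zero] using ha
  · intro b _
    obtain ⟨h1, h2⟩ := hdeg (X - C b) (by rwa [degree_X_sub_C])
    have h3 := Polynomial.card_filter_eval_eq_zero_le h1
    rw [h2] at h3
    refine le_trans (Finset.card_le_card fun a ha => ?_) h3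
    simp only [Finset.mem_filter, Finset.mem_univ, true_and, eval_add, eval_pow, eval_X,
      eval_sub, eval_C] at ha ⊢
    rw [← ha, hσ]
    ring
  · rw [Finset.card_univ, ← Nat.card_eq_fintype_card, hq, pow_two]

open Polynomial in
/-- The norm to the subfield of order `q` is surjective, because it takes each nonzero value at most
`q + 1` times. -/
theorem exists_mul_eq {F : Type*} [Field F] [Finite F] {q : ℕ} (hq : Nat.card F = q ^ 2)
    {σ : F →+* F} (hσ : ∀ a, σ a = a ^ q) {c : F} (hc : σ c = c) : ∃ a, σ a * a = c := by
  classical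
  cases nonempty_fintype F
  have hq2 := two_le_of_card_eq_sq hq
  by_cases hc0 : c = 0
  · exact ⟨0, by simp [hc0]⟩
  have h0 : ((Finset.univ.filter fun a : F => a ≠ 0).filter fun a => σ a * a = c).card =
      q + 1 := by
    refine Finset.card_fiber_eq_of_le (f := fun a => σ a * a)
      (t := Finset.univ.filter fun c => c ≠ 0 ∧ σ c = c) (n := q - 1) ?_ ?_ ?_ ?_
      (by simpa using ⟨hc0, hc⟩)
    · intro a ha
      simp only [Finset.mem_filter, Finset.mem_univ, true_and, map_mul,
        apply_apply_of_card_eq_sq hq hσ] at ha ⊢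
      exact ⟨mul_ne_zero ((map_ne_zero σ).2 ha) ha, mul_comm _ _⟩
    · have h3 := Polynomial.card_filter_eval_eq_zero_le
        (X_pow_sub_C_ne_zero (by omega : 0 < q - 1) (1 : F))
      rw [natDegree_X_pow_sub_C] at h3
      refine le_trans (Finset.card_le_card fun a ha => ?_) h3
      simp only [Finset.mem_filter, Finset.mem_univ, true_and, eval_sub, eval_pow, eval_X,
        eval_C, hσ] at ha ⊢
      obtain ⟨ha0, ha1⟩ := ha
      refine sub_eq_zero.2 (mul_right_cancel₀ ha0 ?_)
      rw [← pow_succ, Nat.sub_add_cancel (by omega), ha1, one_mul]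
    · intro b _
      have h3 := Polynomial.card_filter_eval_eq_zero_le
        (X_pow_sub_C_ne_zero (by omega : 0 < q + 1) b)
      rw [natDegree_X_pow_sub_C] at h3
      refine le_trans (Finset.card_le_card fun a ha => ?_) h3
      simp only [Finset.mem_filter, Finset.mem_univ, true_and, eval_sub, eval_pow, eval_X,
        eval_C, hσ] at ha ⊢
      rw [pow_succ, ha.2, sub_self]
    · rw [Finset.filter_ne', Finset.card_erase_of_mem (Finset.mem_univ _), Finset.card_univ,
        ← Nat.card_eq_fintype_card, hq]
      obtain ⟨k, rfl⟩ : ∃ k, q = k + 1 := ⟨q - 1, by omega⟩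
      simp only [Nat.add_sub_cancel]
      rw [show (k + 1) ^ 2 = k * (k + 1 + 1) + 1 by ring, Nat.add_sub_cancel]
  obtain ⟨a, ha⟩ := Finset.card_pos.1 (by rw [h0]; omega : 0 < Finset.card _)
  exact ⟨a, (Finset.mem_filter.1 ha).2⟩

end FiniteField

open MvPolynomial in
/-- A quadratic form in three variables over a finite field has a nontrivial zero, by the theorem of
Chevalley and Warning. -/
theorem QuadraticForm.exists_apply_eq_zero {F V : Type*} [Field F] [Finite F] [AddCommGroup V]
    [Module F V] (Q : QuadraticForm F V) (v : Fin 3 → V) :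
    ∃ x : Fin 3 → F, x ≠ 0 ∧ Q (x 0 • v 0 + x 1 • v 1 + x 2 • v 2) = 0 := by
  classical
  cases nonempty_fintype F
  obtain ⟨p, hp⟩ := CharP.exists F
  let b : Fin 3 → Fin 3 → F := fun i j => QuadraticMap.polar Q (v i) (v j)
  let f : MvPolynomial (Fin 3) F :=
    C (Q (v 0)) * (X 0 * X 0) + C (Q (v 1)) * (X 1 * X 1) + C (Q (v 2)) * (X 2 * X 2) +
      C (b 0 1) * (X 0 * X 1) + C (b 0 2) * (X 0 * X 2) + C (b 1 2) * (X 1 * X 2)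
  have hmon : ∀ (a : F) (i j : Fin 3), (C a * (X i * X j)).IsHomogeneous 2 := fun a i j =>
    ((isHomogeneous_X F i).mul (isHomogeneous_X F j)).C_mul a
  have hf : f.totalDegree < Fintype.card (Fin 3) := by
    have h1 : f.IsHomogeneous 2 :=
      ((((((hmon _ _ _).add (hmon _ _ _)).add (hmon _ _ _)).add (hmon _ _ _)).add
        (hmon _ _ _)).add (hmon _ _ _))
    have h2 := h1.totalDegree_le
    simp only [Fintype.card_fin]
    omega
  have heval : ∀ x : Fin 3 → F, Q (x 0 • v 0 + x 1 • v 1 + x 2 • v 2) = eval x f := by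
    intro x
    simp only [f, b, map_add, map_mul, eval_C, eval_X, QuadraticMap.map_add Q,
      QuadraticMap.polar_add_left, QuadraticMap.polar_smul_left, QuadraticMap.polar_smul_right,
      QuadraticMap.map_smul, smul_eq_mul]
    ring
  have hdvd := char_dvd_card_solutions p hf
  have hlt : 1 < Fintype.card {x // eval x f = 0} := by
    have h0 : eval 0 f = 0 := by simp [f]
    have hpos : 0 < Fintype.card {x // eval x f = 0} := Fintype.card_pos_iff.2 ⟨⟨0, h0⟩⟩
    have hp1 : p ≠ 1 := CharP.char_ne_one F p
    have hp0 : p ≠ 0 := CharP.char_ne_zero_of_finite F p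
    have := Nat.le_of_dvd hpos hdvd
    omega
  obtain ⟨⟨x, hx⟩, hne⟩ := Fintype.exists_ne_of_one_lt_card hlt ⟨0, by simp [f]⟩
  exact ⟨x, fun h => hne (Subtype.ext h), (heval x).trans hx⟩

/-! ### Symplectic spaces -/

section Alternating

variable {F V : Type*} [Field F] [AddCommGroup V] [Module F V] {B : LinearMap.BilinForm F V}

theorem isPolarSystem_of_isAlt (hB : B.IsAlt) (hnd : B.Nondegenerate) :
    IsPolarSystem (fun W : Submodule F V => ∀ x ∈ W, ∀ y ∈ W, B x y = 0) B where
  mono hle h x hx y hy := h x (hle hx) y (hle hy)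
  le_orthogonal h y hy x hx := h x hx y hy
  sup := by
    intro A C hA hC hAC x hx y hy
    obtain ⟨a, ha, c, hc, rfl⟩ := Submodule.mem_sup.1 hx
    obtain ⟨a', ha', c', hc', rfl⟩ := Submodule.mem_sup.1 hy
    have h1 : B a c' = 0 := hAC hc' a ha
    have h2 : B c a' = 0 := hB.isRefl _ _ (hAC hc a' ha')
    simp [hA a ha a' ha', hC c hc c' hc', h1, h2]
  isRefl := hB.isRefl
  inf_radical _ := (Submodule.eq_bot_iff _).2 fun x hx => hnd.2 x fun y => hx.2 y trivial

theorem LinearMap.IsAlt.apply_eq_zero_of_mem_span (hB : B.IsAlt) (v : V) :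
    ∀ x ∈ F ∙ v, ∀ y ∈ F ∙ v, B x y = 0 := by
  intro x hx y hy
  obtain ⟨a, rfl⟩ := Submodule.mem_span_singleton.1 hx
  obtain ⟨b, rfl⟩ := Submodule.mem_span_singleton.1 hy
  have : B v v = 0 := hB v
  simp [this]

theorem finrank_eq_of_maximal_of_isAlt [FiniteDimensional F V] (hB : B.IsAlt)
    (hnd : B.Nondegenerate) {d : ℕ} (hV : Module.finrank F V = 2 * d) {M : Submodule F V}
    (hM : Maximal (fun W : Submodule F V => ∀ x ∈ W, ∀ y ∈ W, B x y = 0) M) :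
    Module.finrank F M = d := by
  have h := isPolarSystem_of_isAlt hB hnd
  have h1 := h.two_mul_finrank_le hM.1
  have h2 := h.finrank_orthogonal_add hM.1
  by_contra hne
  obtain ⟨v, hv, hvM⟩ := Submodule.exists_mem_notMem_of_finrank_lt
    (A := M) (C := M.orthogonalBilin B) (by omega)
  exact hvM (h.mem_of_mem_orthogonal hM hv (LinearMap.IsAlt.apply_eq_zero_of_mem_span hB v))

theorem ncard_maximal_ge_of_isAlt [Finite F] [FiniteDimensional F V] [Finite V] (hB : B.IsAlt)
    (hnd : B.Nondegenerate) {d : ℕ} (hV : Module.finrank F V = 2 * d) {L M : Submodule F V}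
    (hM : Maximal (fun W : Submodule F V => ∀ x ∈ W, ∀ y ∈ W, B x y = 0) M) (hLM : L ⋖ M) :
    {N | Maximal (fun W : Submodule F V => ∀ x ∈ W, ∀ y ∈ W, B x y = 0) N ∧ L ≤ N}.ncard =
      Nat.card F + 1 := by
  have h := isPolarSystem_of_isAlt hB hnd
  have hself := h.orthogonal_eq_self hM.1
    (by rw [finrank_eq_of_maximal_of_isAlt hB hnd hV hM, hV])
  obtain ⟨e, heM, heL, he⟩ := hLM.exists_sup_span_singleton_eq
  obtain ⟨f, hf, hef⟩ := h.exists_apply_eq_one hM.1 hLM he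
  have hee : B e e = 0 := hB e
  have heL' : e ∈ L.orthogonalBilin B := fun l hl => hM.1 l (hLM.le hl) e heM
  refine h.ncard_maximal_ge hM hLM he (fun a : F => f + a • e)
    (fun a => Submodule.add_mem _ hf (Submodule.smul_mem _ _ heL')) (fun a => by simp [hef, hee])
    (fun a => LinearMap.IsAlt.apply_eq_zero_of_mem_span hB _) (fun a b hab => ?_)
    (fun y hy hey _ => ?_)
  · rw [add_sub_add_left_eq_sub] at hab
    exact Submodule.eq_of_smul_sub_smul_mem heL hab
  · have h1 : y - f ∈ M := by
      rw [← hself, ← he]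
      exact Submodule.mem_orthogonalBilin_sup_span_singleton (Submodule.sub_mem _ hy hf)
        (by simp [hey, hef])
    rw [← he] at h1
    obtain ⟨l, hl, w, hw, hlw⟩ := Submodule.mem_sup.1 h1
    obtain ⟨a, rfl⟩ := Submodule.mem_span_singleton.1 hw
    refine ⟨a, ?_⟩
    rw [← sub_sub, ← hlw, add_sub_cancel_right]
    exact hl

end Alternating

/-! ### Hermitian spaces -/

section Hermitian

variable {F V : Type*} [Field F] [AddCommGroup V] [Module F V] {σ : F →+* F}
  {H : V →ₛₗ[σ] V →ₗ[F] F}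

theorem isPolarSystem_of_isSymm (hH : H.IsSymm) (hnd : H.Nondegenerate) :
    IsPolarSystem (fun W : Submodule F V => ∀ x ∈ W, ∀ y ∈ W, H x y = 0) H where
  mono hle h x hx y hy := h x (hle hx) y (hle hy)
  le_orthogonal h y hy x hx := h x hx y hy
  sup := by
    intro A C hA hC hAC x hx y hy
    obtain ⟨a, ha, c, hc, rfl⟩ := Submodule.mem_sup.1 hx
    obtain ⟨a', ha', c', hc', rfl⟩ := Submodule.mem_sup.1 hy
    have h1 : H a c' = 0 := hAC hc' a ha
    have h2 : H c a' = 0 := hH.isRefl _ _ (hAC hc a' ha')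
    simp [hA a ha a' ha', hC c hc c' hc', h1, h2]
  isRefl := hH.isRefl
  inf_radical _ := (Submodule.eq_bot_iff _).2 fun x hx => hnd.2 x fun y => hx.2 y trivial

theorem LinearMap.apply_eq_zero_of_mem_span_singleton {v : V} (hv : H v v = 0) :
    ∀ x ∈ F ∙ v, ∀ y ∈ F ∙ v, H x y = 0 := by
  intro x hx y hy
  obtain ⟨a, rfl⟩ := Submodule.mem_span_singleton.1 hx
  obtain ⟨b, rfl⟩ := Submodule.mem_span_singleton.1 hy
  simp [hv]

/-- The Witt index is `d`: otherwise two vectors of the orthogonal complement of `M`, independent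
modulo `M`, would have a singular combination, as the norm is surjective. -/
theorem finrank_eq_of_maximal_of_isSymm [Finite F] [FiniteDimensional F V] {q : ℕ}
    (hq : Nat.card F = q ^ 2) (hσ : ∀ a, σ a = a ^ q) (hH : H.IsSymm)
    (hnd : H.Nondegenerate) {d : ℕ} (hV : Module.finrank F V = 2 * d) {M : Submodule F V}
    (hM : Maximal (fun W : Submodule F V => ∀ x ∈ W, ∀ y ∈ W, H x y = 0) M) :
    Module.finrank F M = d := by
  have h := isPolarSystem_of_isSymm hH hnd
  have h1 := h.two_mul_finrank_le hM.1
  have h2 := h.finrank_orthogonal_add hM.1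
  by_contra hne
  obtain ⟨v, hv, hvM⟩ := Submodule.exists_mem_notMem_of_finrank_lt
    (A := M) (C := M.orthogonalBilin H) (by omega)
  have h3 := Submodule.finrank_sup_span_singleton_le M v
  obtain ⟨w, hw, hwM⟩ := Submodule.exists_mem_notMem_of_finrank_lt
    (A := M ⊔ F ∙ v) (C := M.orthogonalBilin H) (by omega)
  have hvv : H v v ≠ 0 := fun hvv =>
    hvM (h.mem_of_mem_orthogonal hM hv (LinearMap.apply_eq_zero_of_mem_span_singleton hvv))
  -- `u` is the part of `w` orthogonal to `v`.
  set u : V := w - (H v w / H v v) • v with hu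
  have hvu : H v u = 0 := by
    rw [hu, map_sub, map_smul, smul_eq_mul, div_mul_cancel₀ _ hvv, sub_self]
  have huv : H u v = 0 := hH.isRefl _ _ hvu
  have hσH : ∀ x, σ (H x x) = H x x := fun x => hH.eq x x
  obtain ⟨a, ha⟩ := FiniteField.exists_mul_eq hq hσ (c := -(H u u / H v v))
    (by rw [map_neg, map_div₀, hσH, hσH])
  have hsing : H (a • v + u) (a • v + u) = 0 := by
    have : H (a • v + u) (a • v + u) = σ a * a * H v v + H u u := by
      simp [hvu, huv]
      ring
    rw [this, ha]
    field_simp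
    ring
  have hmem : a • v + u ∈ M := h.mem_of_mem_orthogonal hM
    (Submodule.add_mem _ (Submodule.smul_mem _ _ hv)
      (Submodule.sub_mem _ hw (Submodule.smul_mem _ _ hv)))
    (LinearMap.apply_eq_zero_of_mem_span_singleton hsing)
  refine hwM (Submodule.mem_sup.2 ⟨_, hmem, (H v w / H v v - a) • v,
    Submodule.smul_mem _ _ (Submodule.mem_span_singleton_self v), ?_⟩)
  rw [hu, sub_smul]
  abel

/-- With `H e f = 1`, the vector `f + a • e` is singular if and only if `a` has trace `-H f f`. -/
theorem ncard_maximal_ge_of_isSymm [Finite F] [FiniteDimensional F V] [Finite V] {q : ℕ}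
    (hq : Nat.card F = q ^ 2) (hσ : ∀ a, σ a = a ^ q) (hH : H.IsSymm)
    (hnd : H.Nondegenerate) {d : ℕ} (hV : Module.finrank F V = 2 * d) {L M : Submodule F V}
    (hM : Maximal (fun W : Submodule F V => ∀ x ∈ W, ∀ y ∈ W, H x y = 0) M) (hLM : L ⋖ M) :
    {N | Maximal (fun W : Submodule F V => ∀ x ∈ W, ∀ y ∈ W, H x y = 0) N ∧ L ≤ N}.ncard =
      q + 1 := by
  have h := isPolarSystem_of_isSymm hH hnd
  have hself := h.orthogonal_eq_self hM.1
    (by rw [finrank_eq_of_maximal_of_isSymm hq hσ hH hnd hV hM, hV])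
  obtain ⟨e, heM, heL, he⟩ := hLM.exists_sup_span_singleton_eq
  obtain ⟨f, hf, hef⟩ := h.exists_apply_eq_one hM.1 hLM he
  have hfe : H f e = 1 := by rw [← hH.eq e f, hef, map_one]
  have hee : H e e = 0 := hM.1 e heM e heM
  have heL' : e ∈ L.orthogonalBilin H := fun l hl => hM.1 l (hLM.le hl) e heM
  have hsing : ∀ a : F, H (f + a • e) (f + a • e) = σ a + a + H f f := by
    intro a
    simp [hef, hfe, hee]
    ring
  rw [← FiniteField.card_add_eq hq hσ (c := -H f f) (by rw [map_neg, hH.eq f f])]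
  refine h.ncard_maximal_ge hM hLM he (fun a : {a : F // σ a + a = -H f f} => f + a.1 • e)
    (fun a => Submodule.add_mem _ hf (Submodule.smul_mem _ _ heL')) (fun a => by simp [hef, hee])
    (fun a => LinearMap.apply_eq_zero_of_mem_span_singleton ?_) (fun a b hab => ?_)
    (fun y hy hey hyS => ?_)
  · rw [hsing, a.2, neg_add_cancel]
  · rw [add_sub_add_left_eq_sub] at hab
    exact Subtype.ext (Submodule.eq_of_smul_sub_smul_mem heL hab)
  · have h1 : y - f ∈ M := by
      rw [← hself, ← he]
      exact Submodule.mem_orthogonalBilin_sup_span_singleton (Submodule.sub_mem _ hy hf)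
        (by simp [hey, hef])
    rw [← he] at h1
    obtain ⟨l, hl, w, hw, hlw⟩ := Submodule.mem_sup.1 h1
    obtain ⟨a, rfl⟩ := Submodule.mem_span_singleton.1 hw
    have hyl : f + a • e = y - l := by
      rw [← eq_sub_iff_add_eq'] at hlw
      rw [hlw]
      abel
    have hyy : H y y = 0 :=
      hyS y (Submodule.mem_span_singleton_self y) y (Submodule.mem_span_singleton_self y)
    have hly : H l y = 0 := hy l hl
    have hyl' : H y l = 0 := hH.isRefl _ _ hly
    have hll : H l l = 0 := hM.1 l (hLM.le hl) l (hLM.le hl)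
    refine ⟨⟨a, ?_⟩, ?_⟩
    · rw [eq_neg_iff_add_eq_zero, ← hsing, hyl]
      simp [hyy, hly, hyl', hll]
    · dsimp only
      rw [hyl, sub_sub_cancel]
      exact hl

end Hermitian

/-! ### Quadratic spaces of odd dimension -/

section Quadratic

variable {F V : Type*} [Field F] [AddCommGroup V] [Module F V] {Q : QuadraticForm F V}

theorem isPolarSystem_of_radical_eq_bot (hQ : Q.radical = ⊥) :
    IsPolarSystem (σ := RingHom.id F) (fun W : Submodule F V => ∀ x ∈ W, Q x = 0)
      (QuadraticMap.polarBilin Q) where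
  mono hle h x hx := h x (hle hx)
  le_orthogonal {W} h y hy x hx := by
    simp [QuadraticMap.polar, h x hx, h y hy, h _ (W.add_mem hx hy)]
  sup := by
    intro A C hA hC hAC x hx
    obtain ⟨a, ha, c, hc, rfl⟩ := Submodule.mem_sup.1 hx
    have h1 : QuadraticMap.polar Q a c = 0 := hAC hc a ha
    rw [QuadraticMap.map_add Q, hA a ha, hC c hc, h1, add_zero, add_zero]
  isRefl x y hxy := by
    rw [QuadraticMap.polarBilin_apply_apply] at hxy ⊢
    rw [QuadraticMap.polar_comm, hxy]
  inf_radical {W} h := by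
    refine (Submodule.eq_bot_iff _).2 fun x hx => ?_
    have h1 : x ∈ Q.radical := by
      refine ⟨h x hx.1, LinearMap.ext fun y => ?_⟩
      have h2 : QuadraticMap.polar Q y x = 0 := hx.2 y trivial
      rw [QuadraticMap.polarBilin_apply_apply, QuadraticMap.polar_comm, h2,
        LinearMap.zero_apply]
    rwa [hQ, Submodule.mem_bot] at h1

theorem QuadraticMap.apply_eq_zero_of_mem_span_singleton {v : V} (hv : Q v = 0) :
    ∀ x ∈ F ∙ v, Q x = 0 := by
  intro x hx
  obtain ⟨a, rfl⟩ := Submodule.mem_span_singleton.1 hx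
  rw [QuadraticMap.map_smul, hv, smul_zero]

/-- The Witt index is `d`: otherwise three vectors of the orthogonal complement of `M`, independent
modulo `M`, would have a singular combination. -/
theorem finrank_eq_of_maximal_of_radical_eq_bot [Finite F] [FiniteDimensional F V]
    (hQ : Q.radical = ⊥) {d : ℕ} (hV : Module.finrank F V = 2 * d + 1) {M : Submodule F V}
    (hM : Maximal (fun W : Submodule F V => ∀ x ∈ W, Q x = 0) M) : Module.finrank F M = d := by
  have h := isPolarSystem_of_radical_eq_bot hQ
  have h1 := h.two_mul_finrank_le hM.1
  have h2 := h.finrank_orthogonal_add hM.1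
  set C := M.orthogonalBilin (QuadraticMap.polarBilin Q) with hC
  by_contra hne
  obtain ⟨v₀, hv₀, hv₀M⟩ := Submodule.exists_mem_notMem_of_finrank_lt (A := M) (C := C) (by omega)
  have h3 := Submodule.finrank_sup_span_singleton_le M v₀
  obtain ⟨v₁, hv₁, hv₁M⟩ := Submodule.exists_mem_notMem_of_finrank_lt
    (A := M ⊔ F ∙ v₀) (C := C) (by omega)
  have h4 := Submodule.finrank_sup_span_singleton_le (M ⊔ F ∙ v₀) v₁
  obtain ⟨v₂, hv₂, hv₂M⟩ := Submodule.exists_mem_notMem_of_finrank_lt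
    (A := M ⊔ F ∙ v₀ ⊔ F ∙ v₁) (C := C) (by omega)
  obtain ⟨x, hx, hQx⟩ := QuadraticForm.exists_apply_eq_zero Q ![v₀, v₁, v₂]
  simp only [Matrix.cons_val] at hQx
  have hmem : x 0 • v₀ + x 1 • v₁ + x 2 • v₂ ∈ M := h.mem_of_mem_orthogonal hM
    (C.add_mem (C.add_mem (C.smul_mem _ hv₀) (C.smul_mem _ hv₁)) (C.smul_mem _ hv₂))
    (QuadraticMap.apply_eq_zero_of_mem_span_singleton hQx)
  have hspan : ∀ (A : Submodule F V) (a : F) (v : V), a • v ∈ A ⊔ F ∙ v := fun A a v =>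
    Submodule.mem_sup_right (Submodule.smul_mem _ _ (Submodule.mem_span_singleton_self v))
  have hx2 : x 2 = 0 := by
    by_contra h5
    refine hv₂M ((Submodule.smul_mem_iff _ h5).1 ?_)
    rw [← Submodule.add_mem_iff_right _ (Submodule.add_mem _
      (Submodule.mem_sup_left (hspan M (x 0) v₀)) (hspan _ (x 1) v₁))]
    exact Submodule.mem_sup_left (Submodule.mem_sup_left hmem)
  rw [hx2, zero_smul, add_zero] at hmem
  have hx1 : x 1 = 0 := by
    by_contra h5
    refine hv₁M ((Submodule.smul_mem_iff _ h5).1 ?_)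
    rw [← Submodule.add_mem_iff_right _ (hspan M (x 0) v₀)]
    exact Submodule.mem_sup_left hmem
  rw [hx1, zero_smul, add_zero] at hmem
  have hx0 : x 0 = 0 := by
    by_contra h5
    exact hv₀M ((Submodule.smul_mem_iff _ h5).1 hmem)
  exact hx (funext fun i => by fin_cases i <;> assumption)

theorem ncard_maximal_ge_of_radical_eq_bot [Finite F] [FiniteDimensional F V] [Finite V]
    (hQ : Q.radical = ⊥) {d : ℕ} (hV : Module.finrank F V = 2 * d + 1) {L M : Submodule F V}
    (hM : Maximal (fun W : Submodule F V => ∀ x ∈ W, Q x = 0) M) (hLM : L ⋖ M) :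
    {N | Maximal (fun W : Submodule F V => ∀ x ∈ W, Q x = 0) N ∧ L ≤ N}.ncard =
      Nat.card F + 1 := by
  have h := isPolarSystem_of_radical_eq_bot hQ
  have hrank := finrank_eq_of_maximal_of_radical_eq_bot hQ hV hM
  have h1 := h.finrank_orthogonal_add hM.1
  set C := M.orthogonalBilin (QuadraticMap.polarBilin Q) with hC
  have hMC : M ≤ C := h.le_orthogonal hM.1
  have hcov : M ⋖ C := Submodule.covBy_iff_finrank_eq.2 ⟨hMC, by omega⟩
  obtain ⟨g, hgC, hgM, hg⟩ := hcov.exists_sup_span_singleton_eq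
  obtain ⟨e, heM, heL, he⟩ := hLM.exists_sup_span_singleton_eq
  obtain ⟨f, hf, hef⟩ := h.exists_apply_eq_one hM.1 hLM he
  rw [QuadraticMap.polarBilin_apply_apply] at hef
  have hee : QuadraticMap.polar Q e e = 0 := hMC heM e heM
  have hQe : Q e = 0 := hM.1 e heM
  have heg : QuadraticMap.polar Q e g = 0 := hgC e heM
  have heL' : e ∈ L.orthogonalBilin (QuadraticMap.polarBilin Q) :=
    Submodule.orthogonalBilin_le hLM.le (hMC heM)
  have hgL : g ∈ L.orthogonalBilin (QuadraticMap.polarBilin Q) :=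
    Submodule.orthogonalBilin_le hLM.le hgC
  have hform : ∀ a c : F, Q (f + a • e + c • g) =
      a + (Q f + c * QuadraticMap.polar Q f g + c * c * Q g) := by
    intro a c
    have hfe : QuadraticMap.polar Q f e = 1 := by rw [QuadraticMap.polar_comm, hef]
    simp only [QuadraticMap.map_add Q, QuadraticMap.polar_add_left, QuadraticMap.polar_smul_left,
      QuadraticMap.polar_smul_right, QuadraticMap.map_smul, smul_eq_mul, hfe, hQe, heg]
    ring
  -- For each `c` exactly one `a` makes `f + a • e + c • g` singular.
  let k : F → F := fun c => -(Q f + c * QuadraticMap.polar Q f g + c * c * Q g)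
  refine h.ncard_maximal_ge hM hLM he (fun c : F => f + k c • e + c • g)
    (fun c => Submodule.add_mem _ (Submodule.add_mem _ hf (Submodule.smul_mem _ _ heL'))
      (Submodule.smul_mem _ _ hgL)) (fun c => ?_)
    (fun c => QuadraticMap.apply_eq_zero_of_mem_span_singleton ?_) (fun c c' hcc => ?_)
    (fun y hy hey hyS => ?_)
  · simp only [QuadraticMap.polarBilin_apply_apply, QuadraticMap.polar_add_right,
      QuadraticMap.polar_smul_right, hef, hee, heg, smul_zero, add_zero]
  · rw [hform, neg_add_cancel]
  · refine Submodule.eq_of_smul_sub_smul_mem hgM ?_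
    have h2 : c • g - c' • g = ((f + k c • e + c • g) - (f + k c' • e + c' • g)) -
        (k c • e - k c' • e) := by abel
    rw [h2]
    exact M.sub_mem (hLM.le hcc) (M.sub_mem (M.smul_mem _ heM) (M.smul_mem _ heM))
  · have h2 : y - f ∈ C := by
      rw [hC, ← he]
      refine Submodule.mem_orthogonalBilin_sup_span_singleton (Submodule.sub_mem _ hy hf) ?_
      rw [map_sub, hey, QuadraticMap.polarBilin_apply_apply, hef, sub_self]
    rw [← hg, ← he] at h2
    obtain ⟨w, hw, w', hw', hww⟩ := Submodule.mem_sup.1 h2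
    obtain ⟨c, rfl⟩ := Submodule.mem_span_singleton.1 hw'
    obtain ⟨l, hl, w'', hw'', rfl⟩ := Submodule.mem_sup.1 hw
    obtain ⟨a, rfl⟩ := Submodule.mem_span_singleton.1 hw''
    have hyl : f + a • e + c • g = y - l := by
      rw [eq_sub_iff_add_eq] at hww
      rw [← hww]
      abel
    have hyy : Q y = 0 := hyS y (Submodule.mem_span_singleton_self y)
    have hly : QuadraticMap.polar Q l y = 0 := hy l hl
    have hll : Q l = 0 := hM.1 l (hLM.le hl)
    have hQ0 : Q (y - l) = 0 := by
      rw [sub_eq_add_neg, QuadraticMap.map_add Q, QuadraticMap.polar_neg_right,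
        QuadraticMap.map_neg, QuadraticMap.polar_comm, hyy, hly, hll, neg_zero, add_zero, add_zero]
    rw [← hyl, hform] at hQ0
    refine ⟨c, ?_⟩
    have hka : k c = a := (eq_neg_of_add_eq_zero_left hQ0).symm
    rw [hka, hyl, sub_sub_cancel]
    exact hl

end Quadratic

theorem theorem1p1 :
    -- `DQ(2d, q)`
    (∀ (d q : ℕ) (F : Type*) (V : Type*) [Field F] [Finite F] [AddCommGroup V] [Module F V]
      (Q : QuadraticForm F V) (m : ℕ) (O : Set (DQ Q).Point),
      3 ≤ d → Nat.card F = q → Module.finrank F V = 2 * d + 1 → Q.radical = ⊥ →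
      (DQ Q).IsMOvoid m O → (DQ Q).IsNontrivial O →
      (DQ Q).IsHemisystem O ∧ 2 * m = q + 1) ∧
    -- `DW(2d-1, q)`
    (∀ (d q : ℕ) (F : Type*) (V : Type*) [Field F] [Finite F] [AddCommGroup V] [Module F V]
      (B : LinearMap.BilinForm F V) (m : ℕ) (O : Set (DW B).Point),
      3 ≤ d → Nat.card F = q → Module.finrank F V = 2 * d → B.IsAlt → B.Nondegenerate →
      (DW B).IsMOvoid m O → (DW B).IsNontrivial O →
      (DW B).IsHemisystem O ∧ 2 * m = q + 1) ∧
    -- `DH(2d-1, q²)`; the form is Hermitian with respect to the involution `x ↦ x ^ q`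
    (∀ (d q : ℕ) (F : Type*) (V : Type*) [Field F] [Finite F] [AddCommGroup V] [Module F V]
      (σ : F →+* F) (H : V →ₛₗ[σ] V →ₗ[F] F) (m : ℕ) (O : Set (DH H).Point),
      3 ≤ d → Nat.card F = q ^ 2 → (∀ a : F, σ a = a ^ q) → Module.finrank F V = 2 * d →
      H.IsSymm → H.Nondegenerate →
      (DH H).IsMOvoid m O → (DH H).IsNontrivial O →
      (DH H).IsHemisystem O ∧ 2 * m = q + 1) := by
  refine ⟨?_, ?_, ?_⟩
  · intro d q F V _ _ _ _ Q m O hd hq hV hQ hm hO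
    have : FiniteDimensional F V := Module.finite_of_finrank_pos (by omega)
    have : Finite V := Module.finite_of_finite F
    subst hq
    exact (isPolarSystem_of_radical_eq_bot hQ).isHemisystem hd
      (fun M hM => finrank_eq_of_maximal_of_radical_eq_bot hQ hV hM)
      (fun L M hM hLM => ncard_maximal_ge_of_radical_eq_bot hQ hV hM hLM)
      Nat.card_pos (Or.inl rfl) hm hO
  · intro d q F V _ _ _ _ B m O hd hq hV hB hnd hm hO
    have : FiniteDimensional F V := Module.finite_of_finrank_pos (by omega)
    have : Finite V := Module.finite_of_finite F
    subst hq
    exact (isPolarSystem_of_isAlt hB hnd).isHemisystem hd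
      (fun M hM => finrank_eq_of_maximal_of_isAlt hB hnd hV hM)
      (fun L M hM hLM => ncard_maximal_ge_of_isAlt hB hnd hV hM hLM)
      Nat.card_pos (Or.inl rfl) hm hO
  · intro d q F V _ _ _ _ σ H m O hd hq hσ hV hH hnd hm hO
    have : FiniteDimensional F V := Module.finite_of_finrank_pos (by omega)
    have : Finite V := Module.finite_of_finite F
    exact (isPolarSystem_of_isSymm hH hnd).isHemisystem hd
      (fun M hM => finrank_eq_of_maximal_of_isSymm hq hσ hH hnd hV hM)
      (fun L M hM hLM => ncard_maximal_ge_of_isSymm hq hσ hH hnd hV hM hLM)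
      (by have := FiniteField.two_le_of_card_eq_sq hq; omega) (Or.inr hq) hm hO
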